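/- **Conventions.** All spaces and maps are pointed, and homotopies are relative to the base point. For a pointed space $X$ with base point $*$ and $I=[0,1]$, let $\mathbb{I}X=X\times I/(\{*\}\times I)$, $\mathrm{C}X=X\times I/(X\times\{0\}\cup\{*\}\times I)$ and $\Sigma X=X\times I/(X\times\{0,1\}\cup\{*\}\times I)$ be the reduced cylinder, cone and suspension, let $i_0:X\to\mathbb{I}X$ be the inclusion of the bottom, and let $\mathbb{I}^n$, $\Sigma^n$ be the iterates. Let $A$ be a pointed space. A pointed map $f:X\to Y$ is an *$A$-weak equivalence* if $f_*:[\Sigma^nA,X]\to[\Sigma^nA,Y]$ is bijective for all $n\ge 0$; it is an *$A$-fibration* if it has the homotopy lifting property (the right lifting property with respect to $i_0:W\to\mathbb{I}W$) for $W=\mathrm{C}\Sigma^{n}A$ and $W=\mathbb{I}^nA$, for all $n\ge 0$; it is an *$A$-cofibration* if it has the left lifting property with respect to all maps that are both $A$-fibrations and $A$-weak equivalences. $\mathcal{T}\!op_A$ denotes the category of pointed topological spaces with these three classes. An adjunction $L\dashv R$ is a *Quillen adjunction* if both categories, with their given classes, are closed model categories, $L$ preserves cofibrations and trivial cofibrations,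 and $R$ preserves fibrations and trivial fibrations. An *H-cogroup* is a pointed space with a comultiplication $A\to A\vee A$ that is, up to pointed homotopy, counital (with respect to the constant map), coassociative and has a two-sided inverse. **Proposition.** 1. Let $A$ and $B$ be pointed spaces that are compact, T$_1$ H-cogroups (compact does not include Hausdorff). If $B$ is a retract of $A$ (there are pointed maps $B\to A\to B$ with composite $\mathrm{Id}_B$), then the identity functors $L:\mathcal{T}\!op_B\to\mathcal{T}\!op_A$ and $R:\mathcal{T}\!op_A\to\mathcal{T}\!op_B$, with the adjunction $L\dashv R$ given by the identity bijections on hom-sets, form a Quillen adjunction. 2. Let $A=\Sigma K$ be the reduced suspension of a pointed compact Hausdorff space $K$ and let $n\ge 1$. Then the identity functors $L:\mathcal{T}\!op_{\Sigma^nA}\to\mathcal{T}\!op_A$ and $R:\mathcal{T}\!op_A\to\mathcal{T}\!op_{\Sigma^nA}$, with the adjunction $L\dashv R$ given by the identity bijections on hom-sets, form a Quillen adjunction. (In particular every $A$-fibration is a $\Sigma^nA$-fibration.) -/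

import Mathlib

open CategoryTheory Limits HomotopicalAlgebra
open scoped unitInterval Topology

universe u

noncomputable section

/-! ### Pointed topological spaces -/

/-- The category of pointed topological spaces and base point preserving continuous maps. -/
abbrev PTop : Type (u + 1) := Under (TopCat.of PUnit.{u + 1})

namespace PTop

/-- The base point of a pointed space. -/
def pt (X : PTop.{u}) : X.right := X.hom PUnit.unit

/-- The pointed space given by a space and one of its points. -/
def of (X : Type u) [TopologicalSpace X] (x : X) : PTop.{u} :=
  Under.mk (TopCat.ofHom (ContinuousMap.const PUnit.{u + 1} x) :
    TopCat.of PUnit.{u + 1} ⟶ TopCat.of X)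

/-- The continuous map underlying a morphism of pointed spaces. -/
abbrev toMap {X Y : PTop.{u}} (f : X ⟶ Y) : C(X.right, Y.right) := f.right.hom

/-- A base point preserving continuous map, as a morphism of pointed spaces. -/
def ofMap {X Y : PTop.{u}} (f : C(X.right, Y.right)) (hf : f X.pt = Y.pt) : X ⟶ Y :=
  Under.homMk (TopCat.ofHom f) (by
    ext x
    cases x
    exact hf)

lemma toMap_pt {X Y : PTop.{u}} (f : X ⟶ Y) : toMap f X.pt = Y.pt :=
  ConcreteCategory.congr_hom (Under.w f) PUnit.unit

/-- The constant map to the base point. -/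
def const (X Y : PTop.{u}) : X ⟶ Y := ofMap (ContinuousMap.const _ Y.pt) rfl

/-! ### Reduced cylinder, cone and suspension -/

/-- The equivalence relation on `Y` that identifies all points of `S` with each other. -/
def collapseSetoid {Y : Type u} (S : Set Y) : Setoid Y where
  r a b := a = b ∨ (a ∈ S ∧ b ∈ S)
  iseqv :=
    { refl := fun _ => Or.inl rfl
      symm := by
        rintro a b (h | ⟨h₁, h₂⟩)
        · exact Or.inl h.symm
        · exact Or.inr ⟨h₂, h₁⟩
      trans := by
        rintro a b c (rfl | ⟨h₁, h₂⟩) (rfl | ⟨h₃, h₄⟩)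
        · exact Or.inl rfl
        · exact Or.inr ⟨h₃, h₄⟩
        · exact Or.inr ⟨h₁, h₂⟩
        · exact Or.inr ⟨h₁, h₄⟩ }

/-- The quotient space `Y / S`, with the quotient topology. -/
abbrev Collapse {Y : Type u} (S : Set Y) : Type u := Quotient (collapseSetoid S)

/-- The projection `Y → Y / S`. -/
def collapseMk {Y : Type u} [TopologicalSpace Y] (S : Set Y) : C(Y, Collapse S) :=
  ⟨fun y => Quotient.mk (collapseSetoid S) y, continuous_quotient_mk'⟩

/-- The subset `{*} × I` of `X × I`. -/
def cylSet (X : PTop.{u}) : Set (X.right × I) := {p | p.1 = X.pt}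

/-- The subset `X × {0} ∪ {*} × I` of `X × I`. -/
def coneSet (X : PTop.{u}) : Set (X.right × I) := {p | p.2 = 0 ∨ p.1 = X.pt}

/-- The subset `X × {0, 1} ∪ {*} × I` of `X × I`. -/
def suspSet (X : PTop.{u}) : Set (X.right × I) := {p | p.2 = 0 ∨ p.2 = 1 ∨ p.1 = X.pt}

/-- The reduced cylinder `X × I / {*} × I`. -/
def cyl (X : PTop.{u}) : PTop.{u} := of (Collapse X.cylSet) (collapseMk X.cylSet (X.pt, 0))

/-- The reduced cone `X × I / (X × {0} ∪ {*} × I)`. -/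
def cone (X : PTop.{u}) : PTop.{u} := of (Collapse X.coneSet) (collapseMk X.coneSet (X.pt, 0))

/-- The reduced suspension `X × I / (X × {0, 1} ∪ {*} × I)`. -/
def susp (X : PTop.{u}) : PTop.{u} := of (Collapse X.suspSet) (collapseMk X.suspSet (X.pt, 0))

/-- The inclusion `i₀ : X → cyl X` into the bottom of the reduced cylinder. -/
def i₀ (X : PTop.{u}) : X ⟶ cyl X :=
  ofMap ((collapseMk X.cylSet).comp ((ContinuousMap.id _).prodMk (ContinuousMap.const _ 0))) rfl

/-- The iterated reduced cylinder. -/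
abbrev cylIter (n : ℕ) (X : PTop.{u}) : PTop.{u} := cyl^[n] X

/-- The iterated reduced suspension. -/
abbrev suspIter (n : ℕ) (X : PTop.{u}) : PTop.{u} := susp^[n] X

/-! ### Pointed homotopies and H-cogroups -/

/-- Pointed maps are homotopic if there is a homotopy between them relative to the base point. -/
def Homotopic {X Y : PTop.{u}} (f g : X ⟶ Y) : Prop :=
  (toMap f).HomotopicRel (toMap g) {X.pt}

lemma homotopic_equivalence (X Y : PTop.{u}) :
    Equivalence (Homotopic : (X ⟶ Y) → (X ⟶ Y) → Prop) where
  refl f := ContinuousMap.HomotopicRel.refl (toMap f)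
  symm h := ContinuousMap.HomotopicRel.symm h
  trans h h' := ContinuousMap.HomotopicRel.trans h h'

lemma Homotopic.comp_right {X Y Z : PTop.{u}} {f g : X ⟶ Y} (h : Homotopic f g) (p : Y ⟶ Z) :
    Homotopic (f ≫ p) (g ≫ p) :=
  ContinuousMap.HomotopicRel.comp_continuousMap h (toMap p)

/-- The relation of pointed homotopy on the pointed maps `X → Y`. -/
def homotopySetoid (X Y : PTop.{u}) : Setoid (X ⟶ Y) := ⟨Homotopic, homotopic_equivalence X Y⟩

/-- The set `[X, Y]` of pointed homotopy classes of pointed maps. -/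
def HomotopyClasses (X Y : PTop.{u}) : Type u := Quotient (homotopySetoid X Y)

/-- The map `[X, Y] → [X, Z]` induced by `f : Y → Z`. -/
def HomotopyClasses.map (X : PTop.{u}) {Y Z : PTop.{u}} (f : Y ⟶ Z) :
    HomotopyClasses X Y → HomotopyClasses X Z :=
  Quotient.map (fun g => g ≫ f) (fun _ _ h => h.comp_right f)

/-- `A` is an H-cogroup: there are a comultiplication `μ : A → A ∨ A` and an inversion
`ν : A → A` such that, up to pointed homotopy, the constant map is a two-sided counit,
`μ` is coassociative and `ν` is a two-sided inverse. The wedge is the coproduct of pointed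
spaces. -/
def IsHCogroup (A : PTop.{u}) : Prop :=
  ∃ (μ : A ⟶ A ⨿ A) (ν : A ⟶ A),
    Homotopic (μ ≫ coprod.desc (𝟙 A) (const A A)) (𝟙 A) ∧
    Homotopic (μ ≫ coprod.desc (const A A) (𝟙 A)) (𝟙 A) ∧
    Homotopic (μ ≫ coprod.map μ (𝟙 A) ≫ (coprod.associator A A A).hom)
      (μ ≫ coprod.map (𝟙 A) μ) ∧
    Homotopic (μ ≫ coprod.desc (𝟙 A) ν) (const A A) ∧
    Homotopic (μ ≫ coprod.desc ν (𝟙 A)) (const A A)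

/-! ### The classes of maps attached to a core `A` -/

/-- `p` has the (pointed) homotopy lifting property with respect to the space `X`. -/
def HLP {E B : PTop.{u}} (p : E ⟶ B) (X : PTop.{u}) : Prop := HasLiftingProperty (i₀ X) p

/-- `A`-weak equivalences: the maps inducing bijections on `πₙᴬ = [Σⁿ A, -]` for all `n ≥ 0`. -/
def weakEquiv (A : PTop.{u}) : MorphismProperty PTop.{u} := fun _ _ f =>
  ∀ n : ℕ, Function.Bijective (HomotopyClasses.map (suspIter n A) f)

/-- `A`-fibrations: the maps with the homotopy lifting property with respect to
`C Σⁿ A` and to `𝕀ⁿ A`, for all `n ≥ 0` (in particular with respect to `A`). -/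
def fib (A : PTop.{u}) : MorphismProperty PTop.{u} := fun _ _ p =>
  (∀ n : ℕ, HLP p (cone (suspIter n A))) ∧ (∀ n : ℕ, HLP p (cylIter n A))

/-- `A`-cofibrations: the maps with the left lifting property with respect to all `A`-fibrations
that are `A`-weak equivalences. -/
def cof (A : PTop.{u}) : MorphismProperty PTop.{u} := (fib A ⊓ weakEquiv A).llp

end PTop

/-- The category of pointed spaces, as carrier of the structure attached to the core `A`. -/
def TopBased (_A : PTop.{u}) : Type (u + 1) := PTop.{u}

namespace TopBased

variable (A : PTop.{u})

instance : Category.{u} (TopBased A) := inferInstanceAs (Category.{u} PTop.{u})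

instance : CategoryWithFibrations (TopBased A) := ⟨PTop.fib A⟩

instance : CategoryWithCofibrations (TopBased A) := ⟨PTop.cof A⟩

instance : CategoryWithWeakEquivalences (TopBased A) := ⟨PTop.weakEquiv A⟩

/-- The identity functor of pointed spaces, from the `B`-based to the `A`-based structure. -/
def idFunctor (B A : PTop.{u}) : TopBased B ⥤ TopBased A := 𝟭 PTop.{u}

/-- The identity functors are adjoint, by the identity bijections on hom-sets. -/
def idAdjunction (B A : PTop.{u}) : idFunctor B A ⊣ idFunctor A B :=
  (Adjunction.id : 𝟭 PTop.{u} ⊣ 𝟭 PTop.{u})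

end TopBased

/-! ### Quillen adjunctions -/

/-- The given classes of fibrations, cofibrations and weak equivalences make `C` a
(closed) model category. -/
def IsModelStructure (C : Type*) [Category C] [hF : CategoryWithFibrations C]
    [hC : CategoryWithCofibrations C] [hW : CategoryWithWeakEquivalences C] : Prop :=
  ∃ M : ModelCategory C, M.categoryWithFibrations = hF ∧ M.categoryWithCofibrations = hC ∧
    M.categoryWithWeakEquivalences = hW

/-- An adjunction `F ⊣ G` between model categories is a Quillen adjunction if `F` preserves
cofibrations and trivial cofibrations and `G` preserves fibrations and trivial fibrations. -/
structure IsQuillenAdjunction {C D : Type*} [Category C] [Category D]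
    [CategoryWithFibrations C] [CategoryWithCofibrations C] [CategoryWithWeakEquivalences C]
    [CategoryWithFibrations D] [CategoryWithCofibrations D] [CategoryWithWeakEquivalences D]
    {F : C ⥤ D} {G : D ⥤ C} (_adj : F ⊣ G) : Prop where
  model_source : IsModelStructure C
  model_target : IsModelStructure D
  map_cofibrations : ∀ {X Y : C} (f : X ⟶ Y), cofibrations C f → cofibrations D (F.map f)
  map_trivialCofibrations : ∀ {X Y : C} (f : X ⟶ Y),
    trivialCofibrations C f → trivialCofibrations D (F.map f)
  map_fibrations : ∀ {X Y : D} (f : X ⟶ Y), fibrations D f → fibrations C (G.map f)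
  map_trivialFibrations : ∀ {X Y : D} (f : X ⟶ Y),
    trivialFibrations D f → trivialFibrations C (G.map f)

end

noncomputable section

namespace PTop

/-! Both halves reduce to two facts about cores: each core involved carries a model structure, and
every fibration or weak equivalence for the target core is one for the source core. Left lifting
then reverses the inclusions, so that the identity preserves cofibrations and trivial cofibrations
(`isQuillenAdjunction_of_le`).

The model structure needs only `HasDifferences`, a weak form of subtracting homotopy classes that
covers H-cogroups and suspensions alike. Trivial fibrations are the maps with the right lifting
property against a set of maps: the cylinder inclusions that define fibrations, the inclusions of
the `Σⁿ A` into their cones, and `* → A` (`rlp_generatingCofibrations`). Differences turn a trivial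
kernel on `[Σⁿ A, -]` into injectivity. All these maps are topological embeddings, and every space
is small relative to embeddings, so the small object argument gives one factorization. The other
comes from the mapping path space, whose projection lifts homotopies of all spaces; it also gives
the lifting of trivial cofibrations against fibrations.

Comparison of cores: cylinders, cones and suspensions preserve retracts, and homotopy lifting and
bijectivity on `[X, -]` pass to retracts. For a suspension, weak equivalences and lifting for cones
only shift an index. Lifting for `𝕀ⁿ Σ A` follows from lifting for `𝕀ⁿ⁺¹ A`: the `n` outer cylinders
are absorbed into path spaces, and a reparametrization of the square turns lifting for a cylinder
into lifting for the suspension (`HLP.susp_of_cyl`). -/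

lemma hom_ext {X Y : PTop.{u}} {f g : X ⟶ Y} (h : ∀ x, toMap f x = toMap g x) : f = g := by
  apply Under.UnderMorphism.ext
  ext x
  exact h x

lemma congr_toMap {X Y : PTop.{u}} {f g : X ⟶ Y} (h : f = g) (x : X.right) :
    toMap f x = toMap g x := by rw [h]

@[simp]
lemma toMap_ofMap {X Y : PTop.{u}} (f : C(X.right, Y.right)) (hf : f X.pt = Y.pt) :
    toMap (ofMap f hf) = f := rfl

@[simp]
lemma toMap_comp {X Y Z : PTop.{u}} (f : X ⟶ Y) (g : Y ⟶ Z) (x : X.right) :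
    toMap (f ≫ g) x = toMap g (toMap f x) := rfl

@[simp]
lemma toMap_id (X : PTop.{u}) (x : X.right) : toMap (𝟙 X) x = x := rfl

@[simp]
lemma const_comp {X Y Z : PTop.{u}} (f : Y ⟶ Z) : const X Y ≫ f = const X Z :=
  hom_ext fun _ => toMap_pt f

lemma hasLiftingProperty_iff {X Y E B : PTop.{u}} (i : X ⟶ Y) (p : E ⟶ B) :
    HasLiftingProperty i p ↔ ∀ (f : X ⟶ E) (g : Y ⟶ B), f ≫ p = i ≫ g →
      ∃ h : Y ⟶ E, i ≫ h = f ∧ h ≫ p = g := by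
  constructor
  · intro _ f g w
    have sq : CommSq f i p g := ⟨w⟩
    exact ⟨sq.lift, sq.fac_left, sq.fac_right⟩
  · intro H
    refine ⟨fun {f g} sq => ?_⟩
    obtain ⟨h, h₁, h₂⟩ := H f g sq.w
    exact ⟨⟨⟨h, h₁, h₂⟩⟩⟩

/-! ### Embeddings and the small object argument -/

/-- The pointed maps that are topological embeddings. -/
def embeddings : MorphismProperty PTop.{u} := fun _ _ f => Topology.IsEmbedding (toMap f)

/-- `Prop` carries the Sierpiński topology, so a map into it is an open set, and `q` records whether
that set contains the base point. Open sets extend along embeddings. -/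
lemma sierpinski_mem_rlp_embeddings (q : Prop) :
    embeddings.rlp (const (of (ULift.{u} Prop) ⟨q⟩) (of PUnit.{u + 1} ⟨⟩)) := by
  intro X Y i hi
  rw [hasLiftingProperty_iff]
  intro f g _
  have hf : IsOpen {x | (toMap f x).down} := by
    rw [← continuous_Prop]
    exact continuous_uliftDown.comp (toMap f).continuous
  obtain ⟨V, hV, hVf⟩ := hi.isInducing.isOpen_iff.1 hf
  have key : ∀ x, toMap i x ∈ V ↔ (toMap f x).down := fun x => Set.ext_iff.1 hVf x
  refine ⟨ofMap ⟨fun y => ⟨y ∈ V⟩, continuous_uliftUp.comp (continuous_Prop.2 hV)⟩ ?_, ?_, ?_⟩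
  · change ULift.up (Y.pt ∈ V) = _
    rw [← toMap_pt i, key, toMap_pt f]
    rfl
  · exact hom_ext fun x => ULift.ext _ _ (propext (key x))
  · exact hom_ext fun x => rfl

/-- The two-point space with the indiscrete topology. -/
def indiscrete (q : Prop) : PTop.{u} := @of (ULift.{u} Prop) ⊤ ⟨q⟩

lemma indiscrete_mem_rlp_embeddings (q : Prop) :
    embeddings.rlp (const (indiscrete.{u} q) (of PUnit.{u + 1} ⟨⟩)) := by
  intro X Y i hi
  rw [hasLiftingProperty_iff]
  intro f g _
  have key : ∀ x, (∃ x', (ULift.down.{u} (toMap f x')) ∧ toMap i x' = toMap i x) ↔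
      ULift.down.{u} (toMap f x) := fun x =>
    ⟨fun ⟨x', h, h'⟩ => hi.injective h' ▸ h, fun h => ⟨x, h, rfl⟩⟩
  refine ⟨ofMap (Y := indiscrete.{u} q)
    ⟨fun y => ULift.up.{u} (∃ x', (ULift.down.{u} (toMap f x')) ∧ toMap i x' = y),
      continuous_top⟩ ?_, ?_, ?_⟩
  · change ULift.up.{u} (∃ x', (ULift.down.{u} (toMap f x')) ∧ toMap i x' = Y.pt) = _
    rw [← toMap_pt i, key, toMap_pt f]
    rfl
  · exact hom_ext fun x => ULift.ext _ _ (propext (key x))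
  · exact hom_ext fun x => rfl

/-- Lifting against the indiscrete space forces injectivity, and lifting against the Sierpiński
space forces the induced topology. As a left lifting class, embeddings are closed under pushouts,
coproducts and transfinite composition. -/
lemma llp_rlp_embeddings : embeddings.{u}.rlp.llp = embeddings := by
  refine le_antisymm ?_ (MorphismProperty.le_llp_rlp _)
  intro X Y i hi
  have inj : Function.Injective (toMap i) := by
    intro x y hxy
    have := hi _ (indiscrete_mem_rlp_embeddings (X.pt = x))
    rw [hasLiftingProperty_iff] at this
    obtain ⟨h, h₁, -⟩ := this
      (ofMap (Y := indiscrete (X.pt = x)) ⟨fun z => ULift.up.{u} (z = x), continuous_top⟩ rfl)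
      (const _ _) (hom_ext fun _ => rfl)
    have e₁ : ULift.down.{u} (toMap h (toMap i x)) = (x = x) :=
      congrArg ULift.down (congr_toMap h₁ x)
    have e₂ : ULift.down.{u} (toMap h (toMap i y)) = (y = x) :=
      congrArg ULift.down (congr_toMap h₁ y)
    rw [hxy, e₂] at e₁
    exact (e₁.mpr rfl).symm
  refine ⟨⟨le_antisymm (toMap i).continuous.le_induced ?_⟩, inj⟩
  intro U hU
  have := hi _ (sierpinski_mem_rlp_embeddings (X.pt ∈ U))
  rw [hasLiftingProperty_iff] at this
  obtain ⟨h, h₁, -⟩ := this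
    (ofMap (Y := of (ULift.{u} Prop) ⟨X.pt ∈ U⟩) ⟨fun z => ULift.up.{u} (z ∈ U),
      continuous_uliftUp.comp (continuous_Prop.2 hU)⟩ rfl)
    (const _ _) (hom_ext fun _ => rfl)
  refine ⟨{y | ULift.down.{u} (toMap h y)},
    continuous_Prop.1 (continuous_uliftDown.comp (toMap h).continuous), ?_⟩
  ext x
  exact Iff.of_eq (congrArg ULift.down (congr_toMap h₁ x))

instance : MorphismProperty.IsStableUnderTransfiniteComposition.{u} embeddings.{u} := by
  rw [← llp_rlp_embeddings]
  infer_instance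

lemma pushouts_coproducts_le_embeddings {M : MorphismProperty PTop.{u}} (hM : M ≤ embeddings) :
    (MorphismProperty.coproducts.{u} M).pushouts ≤ embeddings := by
  rw [← llp_rlp_embeddings] at hM ⊢
  refine (MorphismProperty.pushouts_le_iff).2 ?_
  exact (MorphismProperty.coproducts_le_iff).2 hM

/-- A map from `A` into the colimit hits fewer than `κ` points, so it factors as a function through
one stage. The factorization is continuous because that stage is embedded in the colimit. -/
lemma preservesColimit_coyoneda {J : Type u} [LinearOrder J] {κ : Cardinal.{u}}
    [Fact κ.IsRegular] [IsCardinalFiltered J κ] (F : J ⥤ PTop.{u}) {c : Cocone F}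
    (hc : IsColimit c) (A : PTop.{u}) (hA : HasCardinalLT A.right κ)
    (hι : ∀ j, embeddings (c.ι.app j)) :
    PreservesColimit F (coyoneda.obj (Opposite.op A)) := by
  have := isFiltered_of_isCardinalFiltered J κ
  refine preservesColimit_of_preserves_colimit_cocone hc
    (Types.FilteredColimit.isColimitOf' _ _ ?_ ?_)
  · intro f
    change A ⟶ c.pt at f
    have hs : ∀ y : c.pt.right, ∃ (j : J) (x : (F.obj j).right), toMap (c.ι.app j) x = y := by
      intro y
      have := isColimitOfPreserves (Under.forget _ ⋙ CategoryTheory.forget TopCat) hc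
      obtain ⟨j, x, h⟩ := Types.jointly_surjective _ this y
      exact ⟨j, x, h⟩
    choose j x hx using fun a => hs (toMap f a)
    let k : J := IsCardinalFiltered.max j hA
    let l : A.right → (F.obj k).right := fun a =>
      toMap (F.map (IsCardinalFiltered.toMax j hA a)) (x a)
    have hl : ∀ a, toMap (c.ι.app k) (l a) = toMap f a := fun a => by
      rw [← hx a]
      exact congr_toMap (c.w (IsCardinalFiltered.toMax j hA a)) (x a)
    have hlc : Continuous l := by
      rw [(hι k).isInducing.continuous_iff]
      exact (toMap f).continuous.congr fun a => (hl a).symm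
    refine ⟨k, ofMap ⟨l, hlc⟩ ((hι k).injective ?_), ?_⟩
    · refine (hl A.pt).trans ?_
      rw [toMap_pt f, toMap_pt]
      rfl
    · exact hom_ext fun a => (hl a).symm
  · intro i f g h
    change A ⟶ F.obj i at f g
    refine ⟨i, 𝟙 i, ?_⟩
    have w : f ≫ c.ι.app i = g ≫ c.ι.app i := h
    have : f = g := hom_ext fun a => (hι i).injective (congr_toMap w a)
    rw [this]

/-- A set of embeddings permits the small object argument. -/
lemma hasSmallObjectArgument (M : MorphismProperty PTop.{u}) [MorphismProperty.IsSmall.{u} M]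
    (hM : M ≤ embeddings) : MorphismProperty.HasSmallObjectArgument.{u} M := by
  -- The successor of `c` is regular and exceeds the cardinality of the domain of every map in `M`.
  let c : Cardinal.{u} := Cardinal.aleph0 ⊔ Cardinal.sum
    (fun i : Shrink.{u} M.toSet => Cardinal.mk ((equivShrink M.toSet).symm i).1.left.right)
  let κ := Order.succ c
  have hκ : κ.IsRegular := Cardinal.isRegular_succ le_sup_left
  have : Fact κ.IsRegular := ⟨hκ⟩
  have : Nonempty κ.ord.ToType := by
    rw [← Cardinal.mk_ne_zero_iff, Cardinal.mk_ord_toType]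
    exact hκ.ne_zero
  have : OrderBot κ.ord.ToType := WellFoundedLT.toOrderBot _
  refine ⟨κ, ⟨hκ⟩, this, ?_⟩
  refine { preservesColimit := ?_ }
  intro A B X Y i hi f hf
  let hT := MorphismProperty.TransfiniteCompositionOfShape.ofLE
    hf.transfiniteCompositionOfShape (W' := embeddings)
      (pushouts_coproducts_le_embeddings (by rw [MorphismProperty.ofHoms_homFamily]; exact hM))
  refine preservesColimit_coyoneda (κ := κ) hf.F hf.isColimit A ?_ (fun j => hT.mem_incl_app j)
  rw [hasCardinalLT_iff_cardinal_mk_lt]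
  refine Order.lt_succ_of_le (le_trans ?_ le_sup_right)
  let a : M.toSet := ⟨Arrow.mk i, hi⟩
  have := Cardinal.le_sum (fun i : Shrink.{u} M.toSet =>
    Cardinal.mk ((equivShrink M.toSet).symm i).1.left.right) (equivShrink _ a)
  simpa [a] using this

end PTop

/-! ### Paths and the unit interval -/

/-- The retraction of the real line onto the unit interval. -/
def clip : ℝ → I := Set.projIcc 0 1 zero_le_one

@[fun_prop]
lemma continuous_clip : Continuous clip := continuous_projIcc

lemma coe_clip (a : ℝ) : (clip a : ℝ) = max 0 (min 1 a) := rfl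

@[simp]
lemma clip_coe (t : I) : clip t = t := Set.projIcc_val _ t

lemma clip_of_nonpos {a : ℝ} (h : a ≤ 0) : clip a = 0 := Set.projIcc_of_le_left _ h

lemma clip_of_one_le {a : ℝ} (h : 1 ≤ a) : clip a = 1 := Set.projIcc_of_right_le _ h

lemma coe_clip_of_mem {a : ℝ} (h₀ : 0 ≤ a) (h₁ : a ≤ 1) : (clip a : ℝ) = a := by
  rw [coe_clip, min_eq_right h₁, max_eq_right h₀]

lemma clip_eq_coe {a : ℝ} {t : I} (h : a = t) : clip a = t := by rw [h, clip_coe]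

/-- The concatenation of two homotopies. -/
def concat {X Z : Type*} [TopologicalSpace X] [TopologicalSpace Z] (b r : C(X × I, Z))
    (h : ∀ x, b (x, 1) = r (x, 0)) : C(X × I, Z) where
  toFun a := if (a.2 : ℝ) ≤ 1 / 2 then b (a.1, clip (2 * a.2)) else r (a.1, clip (2 * a.2 - 1))
  continuous_toFun := by
    refine Continuous.if_le (by fun_prop) (by fun_prop) (by fun_prop) (by fun_prop) ?_
    intro a ha
    rw [clip_of_one_le (by linarith), clip_of_nonpos (by linarith)]
    exact h _

section concat

variable {X Z : Type*} [TopologicalSpace X] [TopologicalSpace Z] {b r : C(X × I, Z)}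
  {h : ∀ x, b (x, 1) = r (x, 0)} {x : X} {s : I}

lemma concat_of_le (hs : (s : ℝ) ≤ 1 / 2) : concat b r h (x, s) = b (x, clip (2 * s)) :=
  if_pos hs

lemma concat_of_ge (hs : 1 / 2 ≤ (s : ℝ)) : concat b r h (x, s) = r (x, clip (2 * s - 1)) := by
  rcases hs.lt_or_eq with hs | hs
  · exact if_neg hs.not_ge
  · rw [concat_of_le hs.ge, clip_of_one_le (by linarith), clip_of_nonpos (by linarith), h]

lemma concat_zero : concat b r h (x, 0) = b (x, 0) := by
  rw [concat_of_le (by norm_num), clip_of_nonpos (by norm_num)]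

lemma concat_one : concat b r h (x, 1) = r (x, 1) := by
  rw [concat_of_ge (by norm_num), clip_of_one_le (by norm_num)]

lemma concat_eq {z : Z} (hb : ∀ s, b (x, s) = z) (hr : ∀ s, r (x, s) = z) :
    concat b r h (x, s) = z := by
  rcases le_total (s : ℝ) (1 / 2) with hs | hs
  · rw [concat_of_le hs, hb]
  · rw [concat_of_ge hs, hr]

end concat

/-! ### Pointed path spaces, and homotopies as maps into them. -/

namespace PTop

/-- The space of free paths, pointed by the constant path at the base point. -/
def path (Y : PTop.{u}) : PTop.{u} := of C(I, Y.right) (ContinuousMap.const I Y.pt)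

/-- A point of the path space, as a path. -/
def asPath {Y : PTop.{u}} (γ : (path Y).right) : C(I, Y.right) := γ

lemma asPath_pt (Y : PTop.{u}) (t : I) : asPath (path Y).pt t = Y.pt := rfl

lemma path_ext {Y : PTop.{u}} {γ δ : (path Y).right} (h : ∀ t, asPath γ t = asPath δ t) : γ = δ :=
  ContinuousMap.ext h

/-- The pointed map into the path space given by a pointed homotopy. -/
def curry {X Y : PTop.{u}} (F : C(X.right × I, Y.right)) (hF : ∀ t, F (X.pt, t) = Y.pt) :
    X ⟶ path Y :=
  ofMap (Y := path Y) F.curry (ContinuousMap.ext hF)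

@[simp]
lemma curry_apply {X Y : PTop.{u}} (F : C(X.right × I, Y.right)) (hF : ∀ t, F (X.pt, t) = Y.pt)
    (x : X.right) (t : I) : asPath (toMap (curry F hF) x) t = F (x, t) := rfl

/-- The pointed homotopy given by a pointed map into the path space. -/
def uncurry {X Y : PTop.{u}} (g : X ⟶ path Y) : C(X.right × I, Y.right) :=
  ContinuousMap.uncurry (toMap g)

@[simp]
lemma uncurry_apply {X Y : PTop.{u}} (g : X ⟶ path Y) (x : X.right) (t : I) :
    uncurry g (x, t) = asPath (toMap g x) t := rfl

lemma uncurry_pt {X Y : PTop.{u}} (g : X ⟶ path Y) (t : I) : uncurry g (X.pt, t) = Y.pt := by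
  rw [uncurry_apply, toMap_pt, asPath_pt]

/-- Evaluation of paths. -/
def evalAt (Y : PTop.{u}) (t : I) : path Y ⟶ Y :=
  ofMap (X := path Y) ⟨fun γ => asPath γ t, continuous_eval_const (F := C(I, Y.right)) t⟩ rfl

/-- The map of path spaces induced by a pointed map. -/
def pathMap {X Y : PTop.{u}} (f : X ⟶ Y) : path X ⟶ path Y :=
  ofMap (X := path X) (Y := path Y)
    ⟨fun γ => (toMap f).comp γ, ContinuousMap.continuous_postcomp _⟩
    (ContinuousMap.ext fun _ => toMap_pt f)

lemma pathMap_evalAt {X Y : PTop.{u}} (f : X ⟶ Y) (t : I) :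
    pathMap f ≫ evalAt Y t = evalAt X t ≫ f := rfl

lemma homotopic_iff {X Y : PTop.{u}} {f g : X ⟶ Y} :
    Homotopic f g ↔ ∃ h : X ⟶ path Y, h ≫ evalAt Y 0 = f ∧ h ≫ evalAt Y 1 = g := by
  constructor
  · rintro ⟨H⟩
    refine ⟨curry ⟨fun a => H (a.2, a.1), by fun_prop⟩ fun t => ?_,
      hom_ext fun x => H.apply_zero x, hom_ext fun x => H.apply_one x⟩
    exact (H.eq_fst t rfl).trans (toMap_pt f)
  · rintro ⟨h, rfl, rfl⟩
    refine ⟨⟨⟨⟨fun a => uncurry h (a.2, a.1), by fun_prop⟩, fun x => rfl, fun x => rfl⟩, ?_⟩⟩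
    rintro t x rfl
    exact (uncurry_pt h t).trans (toMap_pt _).symm

lemma homotopic_of {X Y : PTop.{u}} {f g : X ⟶ Y} (F : C(X.right × I, Y.right))
    (hF : ∀ t, F (X.pt, t) = Y.pt) (h₀ : ∀ x, F (x, 0) = toMap f x)
    (h₁ : ∀ x, F (x, 1) = toMap g x) : Homotopic f g :=
  homotopic_iff.2 ⟨curry F hF, hom_ext h₀, hom_ext h₁⟩

lemma Homotopic.exists_homotopy {X Y : PTop.{u}} {f g : X ⟶ Y} (h : Homotopic f g) :
    ∃ F : C(X.right × I, Y.right), (∀ t, F (X.pt, t) = Y.pt) ∧ (∀ x, F (x, 0) = toMap f x) ∧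
      ∀ x, F (x, 1) = toMap g x := by
  obtain ⟨k', rfl, rfl⟩ := homotopic_iff.1 h
  exact ⟨uncurry k', uncurry_pt k', fun _ => rfl, fun _ => rfl⟩

lemma Homotopic.refl {X Y : PTop.{u}} (f : X ⟶ Y) : Homotopic f f :=
  (homotopic_equivalence X Y).refl f

lemma Homotopic.symm {X Y : PTop.{u}} {f g : X ⟶ Y} (h : Homotopic f g) : Homotopic g f :=
  (homotopic_equivalence X Y).symm h

lemma Homotopic.trans {X Y : PTop.{u}} {f g h : X ⟶ Y} (h₁ : Homotopic f g)
    (h₂ : Homotopic g h) : Homotopic f h :=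
  (homotopic_equivalence X Y).trans h₁ h₂

lemma Homotopic.comp_left {X Y Z : PTop.{u}} {f g : Y ⟶ Z} (h : Homotopic f g) (k : X ⟶ Y) :
    Homotopic (k ≫ f) (k ≫ g) := by
  obtain ⟨k', rfl, rfl⟩ := homotopic_iff.1 h
  exact homotopic_iff.2 ⟨k ≫ k', rfl, rfl⟩

/-! ### Quotients of cylinders -/

/-- The quotient of `X × I` by the subset `S`. -/
abbrev collapse (X : PTop.{u}) (S : Set (X.right × I)) : PTop.{u} :=
  of (Collapse S) (collapseMk S (X.pt, 0))

section collapse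

variable {X Y : PTop.{u}} {S : Set (X.right × I)}

/-- The projection onto the quotient. -/
def mkMap (X : PTop.{u}) (S : Set (X.right × I)) : C(X.right × I, (collapse X S).right) :=
  collapseMk S

lemma mkMap_surjective : Function.Surjective (mkMap X S) := Quotient.mk_surjective

lemma mkMap_eq_pt (hS : (X.pt, 0) ∈ S) {a : X.right × I} (ha : a ∈ S) :
    mkMap X S a = (collapse X S).pt :=
  Quotient.sound (Or.inr ⟨ha, hS⟩)

lemma collapse_hom_ext {f g : collapse X S ⟶ Y}
    (h : ∀ x s, toMap f (mkMap X S (x, s)) = toMap g (mkMap X S (x, s))) : f = g := by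
  refine hom_ext fun y => ?_
  obtain ⟨⟨x, s⟩, rfl⟩ := mkMap_surjective y
  exact h x s

/-- A map out of the quotient of `X × I` by `S`. -/
def desc (hS : (X.pt, 0) ∈ S) (F : C(X.right × I, Y.right)) (hF : ∀ a ∈ S, F a = Y.pt) :
    collapse X S ⟶ Y :=
  ofMap (X := collapse X S)
    ⟨Quotient.lift F (by
      rintro a b (h | ⟨h₁, h₂⟩)
      · rw [h]
      · rw [hF a h₁, hF b h₂]), F.continuous.quotient_lift _⟩
    (hF _ hS)

/-- A pointed homotopy on the quotient of `X × I` by `S`. -/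
def descPath (hS : (X.pt, 0) ∈ S) (H : C(X.right × I × I, Y.right))
    (hH : ∀ a ∈ S, ∀ t, H (a.1, a.2, t) = Y.pt) : collapse X S ⟶ path Y :=
  desc (Y := path Y) hS
    (ContinuousMap.curry ⟨fun a : (X.right × I) × I => H (a.1.1, a.1.2, a.2), by fun_prop⟩)
    fun a ha => path_ext fun t => hH a ha t

/-- The homotopy on `X × I` underlying a homotopy on a quotient. -/
def ofPath (g : collapse X S ⟶ path Y) : C(X.right × I × I, Y.right) :=
  ⟨fun a => uncurry g (mkMap X S (a.1, a.2.1), a.2.2), by fun_prop⟩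

@[simp]
lemma ofPath_apply (g : collapse X S ⟶ path Y) (x : X.right) (s t : I) :
    ofPath g (x, s, t) = asPath (toMap g (mkMap X S (x, s))) t := rfl

lemma ofPath_eq_pt (hS : (X.pt, 0) ∈ S) (g : collapse X S ⟶ path Y) {x : X.right} {s : I}
    (h : (x, s) ∈ S) (t : I) : ofPath g (x, s, t) = Y.pt := by
  rw [ofPath_apply, mkMap_eq_pt hS h, toMap_pt, asPath_pt]

end collapse

/-! ### Homotopy lifting in terms of path spaces. -/

lemma cylSet_mem (X : PTop.{u}) : (X.pt, 0) ∈ X.cylSet := rfl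

lemma coneSet_mem (X : PTop.{u}) : (X.pt, 0) ∈ X.coneSet := Or.inl rfl

lemma suspSet_mem (X : PTop.{u}) : (X.pt, 0) ∈ X.suspSet := Or.inl rfl

/-- A map out of the cylinder, as a homotopy. -/
def ofCyl {X Y : PTop.{u}} (g : cyl X ⟶ Y) : X ⟶ path Y :=
  curry ((toMap g).comp (mkMap X X.cylSet)) fun t => by
    refine (congrArg (toMap g) (mkMap_eq_pt (S := X.cylSet) (cylSet_mem X) ?_)).trans (toMap_pt g)
    rfl

/-- A homotopy, as a map out of the cylinder. -/
def toCyl {X Y : PTop.{u}} (h : X ⟶ path Y) : cyl X ⟶ Y :=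
  desc (cylSet_mem X) (uncurry h) (by
    rintro ⟨x, t⟩ (rfl : x = X.pt)
    exact uncurry_pt h t)

lemma ofCyl_toCyl {X Y : PTop.{u}} (h : X ⟶ path Y) : ofCyl (toCyl h) = h := rfl

lemma toCyl_ofCyl {X Y : PTop.{u}} (g : cyl X ⟶ Y) : toCyl (ofCyl g) = g :=
  collapse_hom_ext (S := X.cylSet) fun _ _ => rfl

lemma ofCyl_comp {X Y Z : PTop.{u}} (g : cyl X ⟶ Y) (f : Y ⟶ Z) :
    ofCyl (g ≫ f) = ofCyl g ≫ pathMap f := rfl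

lemma HLP_iff {E B : PTop.{u}} (p : E ⟶ B) (W : PTop.{u}) :
    HLP p W ↔ ∀ (f : W ⟶ E) (H : W ⟶ path B), H ≫ evalAt B 0 = f ≫ p →
      ∃ G : W ⟶ path E, G ≫ evalAt E 0 = f ∧ G ≫ pathMap p = H := by
  rw [HLP, hasLiftingProperty_iff]
  constructor
  · intro h f H w
    obtain ⟨l, h₁, h₂⟩ := h f (toCyl H) w.symm
    exact ⟨ofCyl l, h₁, by rw [← ofCyl_comp, h₂, ofCyl_toCyl]⟩
  · intro h f g w
    obtain ⟨G, h₁, h₂⟩ := h f (ofCyl g) w.symm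
    refine ⟨toCyl G, h₁, ?_⟩
    rw [← toCyl_ofCyl (toCyl G ≫ p), ofCyl_comp, ofCyl_toCyl, h₂, toCyl_ofCyl]

/-- Homotopies are treated as maps into a path space, so they descend along the quotient of `X × I`,
and its product with `I` never has to be recognized as a quotient. -/
lemma HLP_collapse_iff {E B : PTop.{u}} (p : E ⟶ B) {X : PTop.{u}} {S : Set (X.right × I)}
    (hS : (X.pt, 0) ∈ S) :
    HLP p (collapse X S) ↔ ∀ (f : C(X.right × I, E.right)) (H : C(X.right × I × I, B.right)),
      (∀ a ∈ S, f a = E.pt) → (∀ a ∈ S, ∀ t, H (a.1, a.2, t) = B.pt) →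
      (∀ x s, H (x, s, 0) = toMap p (f (x, s))) →
      ∃ G : C(X.right × I × I, E.right), (∀ a ∈ S, ∀ t, G (a.1, a.2, t) = E.pt) ∧
        (∀ x s, G (x, s, 0) = f (x, s)) ∧ ∀ x s t, toMap p (G (x, s, t)) = H (x, s, t) := by
  rw [HLP_iff]
  constructor
  · intro h f H hf hH w
    obtain ⟨G, h₁, h₂⟩ := h (desc hS f hf) (descPath hS H hH)
      (collapse_hom_ext fun x s => w x s)
    refine ⟨ofPath G, fun a ha t => ofPath_eq_pt hS G ha t,
      fun x s => congr_toMap h₁ (mkMap X S (x, s)), fun x s t => ?_⟩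
    exact congrArg (fun γ => asPath γ t) (congr_toMap h₂ (mkMap X S (x, s)))
  · intro h f H w
    obtain ⟨G, h₁, h₂, h₃⟩ := h ((toMap f).comp (mkMap X S)) (ofPath H)
      (fun a ha => (congrArg (toMap f) (mkMap_eq_pt hS ha)).trans (toMap_pt f))
      (fun a ha t => ofPath_eq_pt hS H ha t) (fun x s => congr_toMap w (mkMap X S (x, s)))
    exact ⟨descPath hS G h₁, collapse_hom_ext h₂,
      collapse_hom_ext fun x s => path_ext fun t => h₃ x s t⟩

/-! ### Relative homotopy lifting -/

section cylinder

variable {X Y : PTop.{u}}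

/-- A pointed map into the double path space given by a pointed two-parameter homotopy. -/
def curry₂ (F : C(X.right × I × I, Y.right)) (hF : ∀ s t, F (X.pt, s, t) = Y.pt) :
    X ⟶ path (path Y) :=
  curry (Y := path Y)
    (ContinuousMap.curry ⟨fun a : (X.right × I) × I => F (a.1.1, a.2, a.1.2), by fun_prop⟩)
    fun t => path_ext fun s => hF s t

@[simp]
lemma curry₂_apply (F : C(X.right × I × I, Y.right)) (hF : ∀ s t, F (X.pt, s, t) = Y.pt)
    (x : X.right) (s t : I) : asPath (asPath (toMap (curry₂ F hF) x) t) s = F (x, s, t) := rfl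

/-- The two-parameter homotopy given by a pointed map into the double path space. -/
def uncurry₂ (g : X ⟶ path (path Y)) : C(X.right × I × I, Y.right) :=
  ⟨fun a => ContinuousMap.uncurry (uncurry g : C(X.right × I, C(I, Y.right))) ((a.1, a.2.2), a.2.1),
    by fun_prop⟩

@[simp]
lemma uncurry₂_apply (g : X ⟶ path (path Y)) (x : X.right) (s t : I) :
    uncurry₂ g (x, s, t) = asPath (asPath (toMap g x) t) s := rfl

lemma uncurry₂_pt (g : X ⟶ path (path Y)) (s t : I) : uncurry₂ g (X.pt, s, t) = Y.pt := by
  rw [uncurry₂_apply, toMap_pt, asPath_pt, asPath_pt]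

end cylinder

/-- The exponential law: the cylinder coordinate `s` moves to the path space, while the homotopy
coordinate `t` stays. -/
lemma HLP_cyl_iff {E B : PTop.{u}} (p : E ⟶ B) (W : PTop.{u}) :
    HLP p (cyl W) ↔ HLP (pathMap p) W := by
  refine (HLP_collapse_iff p (cylSet_mem W)).trans ?_
  rw [HLP_iff]
  constructor
  · intro h f H w
    obtain ⟨G, h₁, h₂, h₃⟩ := h (uncurry f) (uncurry₂ H)
      (by rintro ⟨x, t⟩ (rfl : x = W.pt); exact uncurry_pt f t)
      (by rintro ⟨x, s⟩ (rfl : x = W.pt) t; exact uncurry₂_pt H s t)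
      (fun x s => congrArg (fun γ => asPath γ s) (congr_toMap w x))
    exact ⟨curry₂ G fun s t => h₁ (W.pt, s) rfl t, hom_ext fun x => path_ext fun s => h₂ x s,
      hom_ext fun x => path_ext fun t => path_ext fun s => h₃ x s t⟩
  · intro h f H hf hH w
    obtain ⟨G, h₁, h₂⟩ := h (curry f fun t => hf (W.pt, t) rfl)
      (curry₂ H fun s t => hH (W.pt, s) rfl t) (hom_ext fun x => path_ext fun s => w x s)
    refine ⟨uncurry₂ G, ?_, fun x s => congrArg (fun γ => asPath γ s) (congr_toMap h₁ x),
      fun x s t => congrArg (fun γ => asPath (asPath γ t) s) (congr_toMap h₂ x)⟩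
    rintro ⟨x, s⟩ (rfl : x = W.pt) t
    exact uncurry₂_pt G s t

/-- The map `q` is the `n`-fold path space map of `p`. What matters is that it does not depend on
`W`. -/
lemma exists_HLP_cylIter_iff {E B : PTop.{u}} (p : E ⟶ B) (n : ℕ) :
    ∃ (E' B' : PTop.{u}) (q : E' ⟶ B'), ∀ W, HLP p (cylIter n W) ↔ HLP q W := by
  induction n with
  | zero => exact ⟨E, B, p, fun W => Iff.rfl⟩
  | succ n ih =>
    obtain ⟨E', B', q, hq⟩ := ih
    exact ⟨_, _, pathMap q, fun W => (hq (cyl W)).trans (HLP_cyl_iff q W)⟩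

/-- Absolute lifting for the cone gives lifting relative to its base `s = 1`, because the square can
be reparametrized so that the bottom edge covers both the bottom and the side. -/
lemma HLP.cone_rel {E B X : PTop.{u}} {p : E ⟶ B} (h : HLP p (cone X))
    (b r : C(X.right × I, E.right)) (K : C(X.right × I × I, B.right))
    (hb₀ : ∀ x, b (x, 0) = E.pt) (hb : ∀ s, b (X.pt, s) = E.pt) (hr : ∀ t, r (X.pt, t) = E.pt)
    (hbr : ∀ x, b (x, 1) = r (x, 0)) (hK₀ : ∀ x t, K (x, 0, t) = B.pt)
    (hK : ∀ s t, K (X.pt, s, t) = B.pt) (hKb : ∀ x s, K (x, s, 0) = toMap p (b (x, s)))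
    (hKr : ∀ x t, K (x, 1, t) = toMap p (r (x, t))) :
    ∃ G : C(X.right × I × I, E.right), (∀ x t, G (x, 0, t) = E.pt) ∧
      (∀ s t, G (X.pt, s, t) = E.pt) ∧ (∀ x s, G (x, s, 0) = b (x, s)) ∧
      (∀ x t, G (x, 1, t) = r (x, t)) ∧ ∀ x s t, toMap p (G (x, s, t)) = K (x, s, t) := by
  let m : I → I → ℝ := fun s t => min t (1 - s)
  have hm : Continuous fun a : X.right × I × I => m a.2.1 a.2.2 := by fun_prop
  -- This reparametrization of the square bends the edge `t = 0` around the bottom and then up the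
  -- side `s = 1`, and keeps the edge `s = 0` in itself.
  let H : C(X.right × I × I, B.right) :=
    ⟨fun a => K (a.1, clip (min (2 * a.2.1) (1 - m a.2.1 a.2.2)),
      clip (max (2 * a.2.1 + 2 * m a.2.1 a.2.2 - 1) (m a.2.1 a.2.2))), by fun_prop⟩
  have hzero : ∀ a ∈ X.coneSet, concat b r hbr a = E.pt := by
    rintro ⟨x, s⟩ (h | h)
    · change s = 0 at h
      rw [h, concat_zero, hb₀]
    · change x = X.pt at h
      rw [h]
      exact concat_eq hb hr
  have hHzero : ∀ a ∈ X.coneSet, ∀ t, H (a.1, a.2, t) = B.pt := by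
    rintro ⟨x, s⟩ (h | h) t
    · change s = 0 at h
      subst h
      change K (x, clip _, _) = _
      rw [clip_of_nonpos ((min_le_left _ _).trans_eq (by simp)), hK₀]
    · change x = X.pt at h
      rw [h]
      exact hK _ _
  have hstart : ∀ x s, H (x, s, 0) = toMap p (concat b r hbr (x, s)) := by
    intro x s
    obtain ⟨hs, hs'⟩ := s.2
    have e : m s 0 = 0 := min_eq_left (by rw [Set.Icc.coe_zero]; linarith)
    change K (x, clip (min _ (1 - m s 0)), clip (max (_ + 2 * m s 0 - 1) (m s 0))) = _
    rw [e]
    rcases le_total (s : ℝ) (1 / 2) with h | h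
    · rw [concat_of_le h, min_eq_left (by linarith), max_eq_right (by linarith),
        clip_of_nonpos le_rfl, hKb]
    · rw [concat_of_ge h, min_eq_right (by linarith), max_eq_left (by linarith),
        clip_of_one_le (by linarith), hKr]
      congr 4
      ring
  obtain ⟨G, h₁, h₂, h₃⟩ := (HLP_collapse_iff p (coneSet_mem X)).1 h (concat b r hbr) H hzero hHzero hstart
  -- A section of the reparametrization in `H`, which straightens the bottom and the side back to
  -- the edge `t = 0`.
  refine ⟨⟨fun a => G (a.1, clip (max (a.2.1 + (a.2.2 - 1) / 2) (a.2.1 / 2)),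
    clip (min (1 - a.2.1) a.2.2)), by fun_prop⟩, ?_, ?_, ?_, ?_, ?_⟩
  · intro x t
    refine h₁ (x, _) (Or.inl (clip_of_nonpos ?_)) _
    have ht : (t : ℝ) ≤ 1 := t.2.2
    simp only [Set.Icc.coe_zero]
    exact max_le (by linarith) (by norm_num)
  · intro s t
    exact h₁ (X.pt, _) (Or.inr rfl) _
  · intro x s
    have hs := s.2.2
    have hs' := s.2.1
    have e₁ : max ((s : ℝ) + (((0 : I) : ℝ) - 1) / 2) (s / 2) = s / 2 := by
      rw [max_eq_right]; rw [Set.Icc.coe_zero]; linarith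
    have e₂ : clip (min (1 - (s : ℝ)) ((0 : I) : ℝ)) = 0 :=
      clip_of_nonpos ((min_le_right _ _).trans_eq rfl)
    have e₃ : (clip (s / 2) : ℝ) = s / 2 := coe_clip_of_mem (by linarith) (by linarith)
    change G (x, clip (max ((s : ℝ) + (((0 : I) : ℝ) - 1) / 2) (s / 2)),
      clip (min (1 - (s : ℝ)) ((0 : I) : ℝ))) = _
    rw [e₁, e₂, h₂, concat_of_le (by rw [e₃]; linarith), e₃, clip_eq_coe (by ring)]
  · intro x t
    have ht := t.2.2
    have ht' := t.2.1
    have e₁ : max (((1 : I) : ℝ) + ((t : ℝ) - 1) / 2) (((1 : I) : ℝ) / 2) = (1 + t) / 2 := by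
      rw [max_eq_left] <;> rw [Set.Icc.coe_one] <;> linarith
    have e₂ : clip (min (1 - ((1 : I) : ℝ)) (t : ℝ)) = 0 :=
      clip_of_nonpos ((min_le_left _ _).trans_eq (by simp))
    have e₃ : (clip ((1 + t) / 2) : ℝ) = (1 + t) / 2 :=
      coe_clip_of_mem (by linarith) (by linarith)
    change G (x, clip (max (((1 : I) : ℝ) + ((t : ℝ) - 1) / 2) (((1 : I) : ℝ) / 2)),
      clip (min (1 - ((1 : I) : ℝ)) (t : ℝ))) = _
    rw [e₁, e₂, h₂, concat_of_ge (by rw [e₃]; linarith), e₃, clip_eq_coe (by ring)]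
  · intro x s t
    obtain ⟨hs, hs'⟩ := s.2
    obtain ⟨ht, ht'⟩ := t.2
    refine (h₃ _ _ _).trans ?_
    change K (x, clip _, clip _) = K (x, s, t)
    have e₂ : (clip (min (1 - (s : ℝ)) t) : ℝ) = min (1 - (s : ℝ)) t :=
      coe_clip_of_mem (le_min (by linarith) ht) ((min_le_right _ _).trans ht')
    have e₁ : (clip (max ((s : ℝ) + (t - 1) / 2) (s / 2)) : ℝ) =
        max ((s : ℝ) + (t - 1) / 2) (s / 2) :=
      coe_clip_of_mem (le_max_of_le_right (by linarith)) (max_le (by linarith) (by linarith))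
    simp only [m, e₁, e₂]
    rcases le_total ((s : ℝ) + t) 1 with h | h
    · rw [max_eq_right (a := (s : ℝ) + (t - 1) / 2) (by linarith),
        min_eq_right (a := 1 - (s : ℝ)) (by linarith), min_eq_left (a := (t : ℝ)) (by linarith),
        min_eq_left (by linarith), max_eq_right (by linarith), clip_eq_coe (t := s) (by ring),
        clip_coe]
    · rw [max_eq_left (a := (s : ℝ) + (t - 1) / 2) (by linarith),
        min_eq_left (a := 1 - (s : ℝ)) (by linarith),
        min_eq_left (a := 1 - (s : ℝ)) (by linarith),
        min_eq_right (by linarith), max_eq_left (by linarith), clip_eq_coe (t := s) (by ring),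
        clip_eq_coe (t := t) (by ring)]

/-- A lift on the suspension is a lift on the cylinder that is constant on both ends. The bottom
edge of the square is bent around the left side, the bottom and the right side, so absolute lifting
can prescribe all three. -/
lemma HLP.susp_of_cyl {E B X : PTop.{u}} {p : E ⟶ B} (h : HLP p (cyl X)) : HLP p (susp X) := by
  refine (HLP_collapse_iff p (suspSet_mem X)).2 fun f H hf hH w => ?_
  have hf₀ : ∀ x, f (x, 0) = E.pt := fun x => hf (x, 0) (Or.inl rfl)
  have hf₁ : ∀ x, f (x, 1) = E.pt := fun x => hf (x, 1) (Or.inr (Or.inl rfl))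
  have hH₀ : ∀ x t, H (x, 0, t) = B.pt := fun x => hH (x, 0) (Or.inl rfl)
  have hH₁ : ∀ x t, H (x, 1, t) = B.pt := fun x => hH (x, 1) (Or.inr (Or.inl rfl))
  -- In the coordinate `4 s - 2` in `[-2, 2]`, the middle half of the edge `t = 0` maps onto the
  -- bottom and each outer quarter onto one side. Accordingly `f'` is constant on the outer
  -- quarters.
  let K : C(X.right × I × I, B.right) :=
    ⟨fun a => H (a.1, clip ((1 + max (-(1 - (a.2.2 : ℝ)))
        (min (4 * (a.2.1 : ℝ) - 2) (1 - (a.2.2 : ℝ)))) / 2),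
      clip (max (a.2.2 : ℝ) (|4 * (a.2.1 : ℝ) - 2| - 1 + 2 * a.2.2))), by fun_prop⟩
  let f' : C(X.right × I, E.right) := ⟨fun a => f (a.1, clip (2 * a.2 - 1 / 2)), by fun_prop⟩
  have hzero : ∀ a ∈ X.cylSet, f' a = E.pt := by
    rintro ⟨x, s⟩ (rfl : x = X.pt)
    exact hf _ (Or.inr (Or.inr rfl))
  have hHzero : ∀ a ∈ X.cylSet, ∀ t, K (a.1, a.2, t) = B.pt := by
    rintro ⟨x, s⟩ (rfl : x = X.pt) t
    exact hH (X.pt, _) (Or.inr (Or.inr rfl)) _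
  have hstart : ∀ x s, K (x, s, 0) = toMap p (f' (x, s)) := by
    intro x s
    obtain ⟨hs, hs'⟩ := s.2
    change H (x, clip _, clip _) = toMap p (f (x, clip _))
    simp only [Set.Icc.coe_zero, sub_zero, mul_zero, add_zero]
    rcases le_total (s : ℝ) (1 / 4) with h | h
    · rw [min_eq_left (by linarith), max_eq_left (by linarith),
        clip_of_nonpos (a := (1 + -1) / 2) (by norm_num),
        clip_of_nonpos (a := 2 * (s : ℝ) - 1 / 2) (by linarith), hH₀, hf₀, toMap_pt]
    · rcases le_total (3 / 4) (s : ℝ) with h' | h'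
      · rw [min_eq_right (by linarith), max_eq_right (by linarith),
          clip_of_one_le (a := (1 + 1) / 2) (by norm_num),
          clip_of_one_le (a := 2 * (s : ℝ) - 1 / 2) (by linarith), hH₁, hf₁, toMap_pt]
      · have habs : |4 * (s : ℝ) - 2| ≤ 1 := abs_le.2 ⟨by linarith, by linarith⟩
        rw [min_eq_left (by linarith), max_eq_right (by linarith),
          clip_of_nonpos (a := max 0 (|4 * (s : ℝ) - 2| - 1)) (max_le le_rfl (by linarith)), w]
        congr 4
        ring
  obtain ⟨G, h₁, h₂, h₃⟩ := (HLP_collapse_iff p (cylSet_mem X)).1 h f' K hzero hHzero hstart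
  -- The first coordinate, in `[-2, 2]`, of a section of the reparametrization in `K`.
  let a : I → I → ℝ := fun s t => (2 * (s : ℝ) - 1) +
    max 0 ((t : ℝ) + (2 * s - 1) - 1) - max 0 ((t : ℝ) - (2 * s - 1) - 1)
  have ha : Continuous fun y : X.right × I × I => a y.2.1 y.2.2 := by fun_prop
  refine ⟨⟨fun y => G (y.1, clip ((a y.2.1 y.2.2 + 2) / 4),
    clip (min (1 - |2 * (y.2.1 : ℝ) - 1|) y.2.2)), by fun_prop⟩, ?_, ?_, ?_⟩
  · have e : ∀ s : I, |2 * (s : ℝ) - 1| = 1 → ∀ t : I,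
        clip (min (1 - |2 * (s : ℝ) - 1|) t) = 0 := fun s hs t =>
      clip_of_nonpos ((min_le_left _ _).trans_eq (by rw [hs, sub_self]))
    rintro ⟨x, s⟩ hs t
    obtain ⟨ht, ht'⟩ := t.2
    change G (x, clip ((a s t + 2) / 4), clip (min (1 - |2 * (s : ℝ) - 1|) t)) = _
    rcases hs with hs | hs | hs
    · change s = 0 at hs
      subst hs
      rw [e 0 (by norm_num), h₂]
      have : a 0 t = -1 - t := by
        simp only [a, Set.Icc.coe_zero]
        rw [max_eq_left (by linarith), max_eq_right (by linarith)]
        ring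
      change f (x, clip _) = _
      rw [this, clip_of_nonpos, hf₀]
      rw [coe_clip_of_mem (by linarith) (by linarith)]
      linarith
    · change s = 1 at hs
      subst hs
      rw [e 1 (by norm_num), h₂]
      have : a 1 t = 1 + t := by
        simp only [a, Set.Icc.coe_one]
        rw [max_eq_right (by linarith), max_eq_left (by linarith)]
        ring
      change f (x, clip _) = _
      rw [this, clip_of_one_le, hf₁]
      rw [coe_clip_of_mem (by linarith) (by linarith)]
      linarith
    · exact h₁ (x, clip _) hs _
  · intro x s
    obtain ⟨hs, hs'⟩ := s.2
    have e : a s 0 = 2 * s - 1 := by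
      simp only [a, Set.Icc.coe_zero]
      rw [max_eq_left (by linarith), max_eq_left (by linarith)]
      ring
    change G (x, clip ((a s 0 + 2) / 4), clip (min (1 - |2 * (s : ℝ) - 1|) ((0 : I) : ℝ))) = _
    rw [clip_of_nonpos (a := min (1 - |2 * (s : ℝ) - 1|) ((0 : I) : ℝ)) (min_le_right _ _), h₂, e]
    change f (x, clip _) = _
    rw [coe_clip_of_mem (by linarith) (by linarith), clip_eq_coe (t := s) (by ring)]
  · intro x s t
    obtain ⟨hs, hs'⟩ := s.2
    obtain ⟨ht, ht'⟩ := t.2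
    refine (h₃ _ _ _).trans ?_
    have habs : |2 * (s : ℝ) - 1| ≤ 1 := abs_le.2 ⟨by linarith, by linarith⟩
    have e₁ : (clip (min (1 - |2 * (s : ℝ) - 1|) t) : ℝ) = min (1 - |2 * (s : ℝ) - 1|) t :=
      coe_clip_of_mem (le_min (by linarith) ht) ((min_le_right _ _).trans ht')
    have e₂ : (clip ((a s t + 2) / 4) : ℝ) = (a s t + 2) / 4 := by
      refine coe_clip_of_mem ?_ ?_ <;>
      · simp only [a]
        rcases max_cases 0 ((t : ℝ) + (2 * s - 1) - 1) with h | h <;>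
        rcases max_cases 0 ((t : ℝ) - (2 * s - 1) - 1) with h' | h' <;> linarith
    change H (x, clip _, clip _) = H (x, s, t)
    simp only [e₁, e₂]
    have e₃ : 4 * ((a s t + 2) / 4) - 2 = a s t := by ring
    rw [e₃]
    have key : (1 + max (-(1 - min (1 - |2 * (s : ℝ) - 1|) t))
        (min (a s t) (1 - min (1 - |2 * (s : ℝ) - 1|) t))) / 2 = s ∧
        max (min (1 - |2 * (s : ℝ) - 1|) (t : ℝ))
          (|a s t| - 1 + 2 * min (1 - |2 * (s : ℝ) - 1|) t) = t := by
      rcases le_total 0 (2 * (s : ℝ) - 1) with hσ | hσ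
      · have e : a s t = (2 * (s : ℝ) - 1) + max 0 ((t : ℝ) + (2 * s - 1) - 1) := by
          simp only [a]
          rw [max_eq_left (b := (t : ℝ) - (2 * s - 1) - 1) (by linarith), sub_zero]
        rw [e, abs_of_nonneg hσ, abs_of_nonneg (by positivity)]
        rcases le_total ((t : ℝ) + (2 * s - 1)) 1 with h | h
        · rw [max_eq_left (b := (t : ℝ) + (2 * s - 1) - 1) (by linarith),
            min_eq_right (b := (t : ℝ)) (by linarith), min_eq_left (by linarith),
            max_eq_right (by linarith), max_eq_left (by linarith)]
          exact ⟨by ring, rfl⟩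
        · rw [max_eq_right (b := (t : ℝ) + (2 * s - 1) - 1) (by linarith),
            min_eq_left (b := (t : ℝ)) (by linarith), min_eq_right (by linarith),
            max_eq_right (by linarith), max_eq_right (by linarith)]
          exact ⟨by ring, by ring⟩
      · have e : a s t = (2 * (s : ℝ) - 1) - max 0 ((t : ℝ) - (2 * s - 1) - 1) := by
          simp only [a]
          rw [max_eq_left (b := (t : ℝ) + (2 * s - 1) - 1) (by linarith), add_zero]
        have hn : a s t ≤ 0 := by
          rw [e]
          linarith [le_max_left 0 ((t : ℝ) - (2 * s - 1) - 1)]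
        rw [abs_of_nonpos hn, e, abs_of_nonpos hσ]
        rcases le_total ((t : ℝ) - (2 * s - 1)) 1 with h | h
        · rw [max_eq_left (b := (t : ℝ) - (2 * s - 1) - 1) (by linarith),
            min_eq_right (b := (t : ℝ)) (by linarith), min_eq_left (by linarith),
            max_eq_right (by linarith), max_eq_left (by linarith)]
          exact ⟨by ring, rfl⟩
        · rw [max_eq_right (b := (t : ℝ) - (2 * s - 1) - 1) (by linarith),
            min_eq_left (b := (t : ℝ)) (by linarith), min_eq_left (by linarith),
            max_eq_left (by linarith), max_eq_right (by linarith)]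
          exact ⟨by ring, by ring⟩
    rw [key.1, key.2, clip_coe, clip_coe]


/-! ### Differences of homotopy classes -/

/-- A pointed space `X` has differences if for all `f g : X ⟶ E` there is `w : X ⟶ E` whose images
are null-homotopic where those of `f` and `g` are homotopic, and which is itself null-homotopic
only if `f` and `g` are homotopic. -/
def HasDifferences (X : PTop.{u}) : Prop :=
  ∀ ⦃E : PTop.{u}⦄ (f g : X ⟶ E), ∃ w : X ⟶ E,
    (∀ ⦃B : PTop.{u}⦄ (p : E ⟶ B), Homotopic (f ≫ p) (g ≫ p) →
      Homotopic (w ≫ p) (const X B)) ∧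
    (Homotopic w (const X E) → Homotopic f g)

lemma homotopic_desc {A E : PTop.{u}} {f f' g g' : A ⟶ E} (hf : Homotopic f f')
    (hg : Homotopic g g') : Homotopic (coprod.desc f g) (coprod.desc f' g') := by
  obtain ⟨h, rfl, rfl⟩ := homotopic_iff.1 hf
  obtain ⟨k, rfl, rfl⟩ := homotopic_iff.1 hg
  exact homotopic_iff.2 ⟨coprod.desc h k, by ext1 <;> simp, by ext1 <;> simp⟩

/-- Take `w = f - g`. Additively, `f ≃ f + (-g + g) ≃ (f - g) + g`, which is homotopic to `g` once
`f - g` is null. -/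
lemma IsHCogroup.hasDifferences {A : PTop.{u}} (hA : IsHCogroup A) : HasDifferences A := by
  obtain ⟨μ, ν, h₁, h₂, h₃, h₄, h₅⟩ := hA
  intro E f g
  refine ⟨μ ≫ coprod.desc f (ν ≫ g), fun B p h => ?_, fun h => ?_⟩
  · have e : (μ ≫ coprod.desc f (ν ≫ g)) ≫ p = μ ≫ coprod.desc (f ≫ p) (ν ≫ g ≫ p) := by simp
    rw [e]
    refine ((homotopic_desc h (Homotopic.refl _)).comp_left μ).trans ?_
    have := h₄.comp_right (g ≫ p)
    simpa using this
  · have s₁ : Homotopic f (μ ≫ coprod.desc f (μ ≫ coprod.desc (ν ≫ g) g)) := by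
      have := h₁.comp_right f
      refine Homotopic.trans (g := μ ≫ coprod.desc f (const A E)) (by simpa using this.symm) ?_
      refine (homotopic_desc (Homotopic.refl f) ?_).comp_left μ
      have := h₅.comp_right g
      simpa using this.symm
    have s₂ : Homotopic (μ ≫ coprod.desc (μ ≫ coprod.desc f (ν ≫ g)) g)
        (μ ≫ coprod.desc f (μ ≫ coprod.desc (ν ≫ g) g)) := by
      have := h₃.comp_right (coprod.desc f (coprod.desc (ν ≫ g) g))
      have e : coprod.map μ (𝟙 A) ≫ (coprod.associator A A A).hom ≫
          coprod.desc f (coprod.desc (ν ≫ g) g) = coprod.desc (μ ≫ coprod.desc f (ν ≫ g)) g := by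
        have e₁ : coprod.inl ≫ coprod.desc f (coprod.desc (ν ≫ g) g) = f := coprod.inl_desc _ _
        have e₂ : coprod.inr ≫ coprod.desc f (coprod.desc (ν ≫ g) g) = coprod.desc (ν ≫ g) g :=
          coprod.inr_desc _ _
        have e₃ : coprod.inl ≫ coprod.desc (ν ≫ g) g = ν ≫ g := coprod.inl_desc _ _
        have e₄ : coprod.inr ≫ coprod.desc (ν ≫ g) g = g := coprod.inr_desc _ _
        simp [coprod.associator, e₁, e₂, e₃, e₄]
      rw [Category.assoc, Category.assoc, e] at this
      simpa using this
    have s₃ : Homotopic (μ ≫ coprod.desc (μ ≫ coprod.desc f (ν ≫ g)) g) g := by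
      refine ((homotopic_desc h (Homotopic.refl g)).comp_left μ).trans ?_
      have := h₂.comp_right g
      simpa using this
    exact s₁.trans (s₂.symm.trans s₃)

/-! ### Suspensions and cones on the level of the cylinder. -/

lemma susp_mk_zero {X : PTop.{u}} (x : X.right) : mkMap X X.suspSet (x, 0) = (susp X).pt :=
  mkMap_eq_pt (suspSet_mem X) (Or.inl rfl)

lemma susp_mk_one {X : PTop.{u}} (x : X.right) : mkMap X X.suspSet (x, 1) = (susp X).pt :=
  mkMap_eq_pt (suspSet_mem X) (Or.inr (Or.inl rfl))

lemma susp_mk_pt (X : PTop.{u}) (s : I) : mkMap X X.suspSet (X.pt, s) = (susp X).pt :=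
  mkMap_eq_pt (suspSet_mem X) (Or.inr (Or.inr rfl))

lemma cone_mk_zero {X : PTop.{u}} (x : X.right) : mkMap X X.coneSet (x, 0) = (cone X).pt :=
  mkMap_eq_pt (coneSet_mem X) (Or.inl rfl)

lemma cone_mk_pt (X : PTop.{u}) (s : I) : mkMap X X.coneSet (X.pt, s) = (cone X).pt :=
  mkMap_eq_pt (coneSet_mem X) (Or.inr rfl)

/-- Homotopies of maps out of a suspension, on the level of the cylinder. -/
lemma homotopic_susp_iff {X Y : PTop.{u}} {f g : susp X ⟶ Y} :
    Homotopic f g ↔ ∃ F : C(X.right × I × I, Y.right),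
      (∀ x t, F (x, 0, t) = Y.pt) ∧ (∀ x t, F (x, 1, t) = Y.pt) ∧
      (∀ s t, F (X.pt, s, t) = Y.pt) ∧
      (∀ x s, F (x, s, 0) = toMap f (mkMap X X.suspSet (x, s))) ∧
      ∀ x s, F (x, s, 1) = toMap g (mkMap X X.suspSet (x, s)) := by
  rw [homotopic_iff]
  constructor
  · rintro ⟨h, rfl, rfl⟩
    exact ⟨ofPath (S := X.suspSet) h,
      fun x t => ofPath_eq_pt (suspSet_mem X) h (x := x) (s := 0) (Or.inl rfl) t,
      fun x t => ofPath_eq_pt (suspSet_mem X) h (x := x) (s := 1) (Or.inr (Or.inl rfl)) t,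
      fun s t => ofPath_eq_pt (suspSet_mem X) h (x := X.pt) (s := s) (Or.inr (Or.inr rfl)) t,
      fun _ _ => rfl, fun _ _ => rfl⟩
  · rintro ⟨F, h₁, h₂, h₃, h₄, h₅⟩
    refine ⟨descPath (suspSet_mem X) F ?_, collapse_hom_ext h₄, collapse_hom_ext h₅⟩
    rintro ⟨x, s⟩ (h | h | h) t
    · change s = 0 at h
      rw [h, h₁]
    · change s = 1 at h
      rw [h, h₂]
    · change x = X.pt at h
      rw [h, h₃]

/-- The difference runs through `f`, rests at the base point for the middle third, and runs back
through `g`. -/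
lemma hasDifferences_susp (X : PTop.{u}) : HasDifferences (susp X) := by
  intro E f g
  let f' : C(X.right × I, E.right) := (toMap f).comp (mkMap X X.suspSet)
  let g' : C(X.right × I, E.right) := (toMap g).comp (mkMap X X.suspSet)
  have f₁ : ∀ x, f' (x, 1) = E.pt := fun x =>
    (congrArg (toMap f) (susp_mk_one x)).trans (toMap_pt f)
  have g₁ : ∀ x, g' (x, 1) = E.pt := fun x =>
    (congrArg (toMap g) (susp_mk_one x)).trans (toMap_pt g)
  have f₀ : ∀ x, f' (x, 0) = E.pt := fun x =>
    (congrArg (toMap f) (susp_mk_zero x)).trans (toMap_pt f)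
  have g₀ : ∀ x, g' (x, 0) = E.pt := fun x =>
    (congrArg (toMap g) (susp_mk_zero x)).trans (toMap_pt g)
  have fpt : ∀ s, f' (X.pt, s) = E.pt := fun s =>
    (congrArg (toMap f) (susp_mk_pt X s)).trans (toMap_pt f)
  have gpt : ∀ s, g' (X.pt, s) = E.pt := fun s =>
    (congrArg (toMap g) (susp_mk_pt X s)).trans (toMap_pt g)
  let w' : C(X.right × I, E.right) :=
    { toFun := fun a => if (a.2 : ℝ) ≤ 1 / 2 then f' (a.1, clip (3 * a.2))
        else g' (a.1, clip (3 - 3 * a.2))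
      continuous_toFun := by
        refine Continuous.if_le (by fun_prop) (by fun_prop) (by fun_prop) (by fun_prop) ?_
        intro a ha
        rw [clip_of_one_le (by linarith), clip_of_one_le (by linarith), f₁, g₁] }
  have w_le : ∀ x (s : I), (s : ℝ) ≤ 1 / 2 → w' (x, s) = f' (x, clip (3 * s)) :=
    fun x s h => if_pos h
  have w_ge : ∀ x (s : I), 1 / 2 ≤ (s : ℝ) → w' (x, s) = g' (x, clip (3 - 3 * s)) := by
    intro x s h
    rcases h.lt_or_eq with h | h
    · exact if_neg h.not_ge
    · rw [w_le x s h.ge, clip_of_one_le (by linarith), clip_of_one_le (by linarith), f₁, g₁]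
  have w_mid : ∀ x (s : I), 1 / 3 ≤ (s : ℝ) → (s : ℝ) ≤ 2 / 3 → w' (x, s) = E.pt := by
    intro x s h h'
    rcases le_total (s : ℝ) (1 / 2) with hs | hs
    · rw [w_le x s hs, clip_of_one_le (by linarith), f₁]
    · rw [w_ge x s hs, clip_of_one_le (by linarith), g₁]
  have wpt : ∀ s, w' (X.pt, s) = E.pt := by
    intro s
    rcases le_total (s : ℝ) (1 / 2) with hs | hs
    · rw [w_le _ s hs, fpt]
    · rw [w_ge _ s hs, gpt]
  have hw : ∀ a ∈ X.suspSet, w' a = E.pt := by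
    rintro ⟨x, s⟩ (h | h | h)
    · change s = 0 at h
      rw [h, w_le _ _ (by norm_num), clip_of_nonpos (by norm_num), f₀]
    · change s = 1 at h
      rw [h, w_ge _ _ (by norm_num), clip_of_nonpos (by norm_num), g₀]
    · change x = X.pt at h
      rw [h, wpt]
  refine ⟨desc (suspSet_mem X) w' hw, fun B p h => ?_, fun h => ?_⟩
  · obtain ⟨Q, q₀, q₁, qpt, qf, qg⟩ := homotopic_susp_iff.1 h
    -- At `t = 0` this path traverses the start, the edge `s = 1` and the end of `Q`. It is then
    -- contracted into the edge `s = 0`.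
    refine homotopic_susp_iff.2 ⟨⟨fun a => Q (a.1,
      clip ((1 - a.2.2) * clip (min (3 * a.2.1) (3 - 3 * a.2.1))), clip (3 * a.2.1 - 1)),
      by fun_prop⟩, fun x t => ?_, fun x t => ?_, fun s t => qpt _ _, fun x s => ?_, fun x s => ?_⟩
    · change Q (x, clip (_ * clip _), _) = _
      rw [clip_of_nonpos (a := min _ _) ((min_le_left _ _).trans_eq (by simp)), Set.Icc.coe_zero,
        mul_zero, clip_of_nonpos le_rfl, q₀]
    · change Q (x, clip (_ * clip _), _) = _
      rw [clip_of_nonpos (a := min _ _) ((min_le_right _ _).trans_eq (by simp)), Set.Icc.coe_zero,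
        mul_zero, clip_of_nonpos le_rfl, q₀]
    · change Q (x, clip ((1 - ((0 : I) : ℝ)) * clip _), clip (3 * (s : ℝ) - 1)) =
        toMap p (w' (x, s))
      rw [Set.Icc.coe_zero, sub_zero, one_mul, clip_coe]
      rcases le_total (s : ℝ) (1 / 3) with h₁ | h₁
      · rw [w_le x s (by linarith), min_eq_left (by linarith),
          clip_of_nonpos (a := 3 * (s : ℝ) - 1) (by linarith)]
        exact qf x _
      · rcases le_total (2 / 3) (s : ℝ) with h₂ | h₂
        · rw [w_ge x s (by linarith), min_eq_right (by linarith),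
            clip_of_one_le (a := 3 * (s : ℝ) - 1) (by linarith)]
          exact qg x _
        · rw [w_mid x s h₁ h₂, clip_of_one_le (le_min (by linarith) (by linarith)), q₁, toMap_pt]
    · change Q (x, clip ((1 - ((1 : I) : ℝ)) * clip _), _) = _
      rw [Set.Icc.coe_one, sub_self, zero_mul, clip_of_nonpos le_rfl, q₀]
      rfl
  · obtain ⟨F, F₀, F₁, Fpt, Fw, Fc⟩ := homotopic_susp_iff.1 h
    replace Fw : ∀ x s, F (x, s, 0) = w' (x, s) := Fw
    replace Fc : ∀ x s, F (x, s, 1) = E.pt := Fc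
    -- Linear interpolation in the square of `F` between two curves in `t` on which `F` is constant:
    -- the left, top and right edges (`s = 0`), and the middle third of the bottom (`s = 1`). The
    -- ends `t = 0` and `t = 1` trace the outer thirds of the bottom, where `w'` is `f` and `g`.
    refine homotopic_susp_iff.2 ⟨⟨fun a => F (a.1,
      clip ((1 - a.2.1) * clip (3 * a.2.2 - 1) + a.2.1 * ((1 + a.2.2) / 3)),
      clip ((1 - a.2.1) * min (3 * (a.2.2 : ℝ)) (3 - 3 * a.2.2))),
      by fun_prop⟩, fun x t => ?_, fun x t => ?_, fun s t => Fpt _ _, fun x s => ?_, fun x s => ?_⟩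
    · change F (x, clip ((1 - ((0 : I) : ℝ)) * clip (3 * (t : ℝ) - 1) +
        ((0 : I) : ℝ) * ((1 + t) / 3)),
        clip ((1 - ((0 : I) : ℝ)) * min (3 * (t : ℝ)) (3 - 3 * t))) = _
      rw [Set.Icc.coe_zero, sub_zero, one_mul, zero_mul, add_zero, one_mul, clip_coe]
      rcases le_total (t : ℝ) (1 / 3) with h₁ | h₁
      · rw [clip_of_nonpos (a := 3 * (t : ℝ) - 1) (by linarith), F₀]
      · rcases le_total (2 / 3) (t : ℝ) with h₂ | h₂
        · rw [clip_of_one_le (a := 3 * (t : ℝ) - 1) (by linarith), F₁]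
        · rw [clip_of_one_le (a := min _ _) (le_min (by linarith) (by linarith)), Fc]
    · obtain ⟨ht, ht'⟩ := t.2
      change F (x, clip ((1 - ((1 : I) : ℝ)) * clip (3 * (t : ℝ) - 1) +
        ((1 : I) : ℝ) * ((1 + t) / 3)),
        clip ((1 - ((1 : I) : ℝ)) * min (3 * (t : ℝ)) (3 - 3 * t))) = _
      rw [Set.Icc.coe_one, sub_self, zero_mul, one_mul, zero_add, zero_mul, clip_of_nonpos le_rfl,
        Fw]
      refine w_mid _ _ ?_ ?_ <;> rw [coe_clip_of_mem (by linarith) (by linarith)] <;> linarith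
    · obtain ⟨hs, hs'⟩ := s.2
      change F (x, clip ((1 - (s : ℝ)) * clip (3 * ((0 : I) : ℝ) - 1) +
        (s : ℝ) * ((1 + ((0 : I) : ℝ)) / 3)),
        clip ((1 - (s : ℝ)) * min (3 * ((0 : I) : ℝ)) (3 - 3 * ((0 : I) : ℝ)))) = f' (x, s)
      rw [Set.Icc.coe_zero, clip_of_nonpos (a := 3 * (0 : ℝ) - 1) (by norm_num),
        min_eq_left (by norm_num), mul_zero, mul_zero, clip_of_nonpos (a := (0 : ℝ)) le_rfl, Fw,
        Set.Icc.coe_zero, mul_zero, zero_add]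
      have e : (clip ((s : ℝ) * ((1 + 0) / 3)) : ℝ) = s / 3 := by
        rw [coe_clip_of_mem (by linarith) (by linarith)]
        ring
      rw [w_le _ _ (by rw [e]; linarith), e, clip_eq_coe (t := s) (by ring)]
    · obtain ⟨hs, hs'⟩ := s.2
      change F (x, clip ((1 - (s : ℝ)) * clip (3 * ((1 : I) : ℝ) - 1) +
        (s : ℝ) * ((1 + ((1 : I) : ℝ)) / 3)),
        clip ((1 - (s : ℝ)) * min (3 * ((1 : I) : ℝ)) (3 - 3 * ((1 : I) : ℝ)))) = g' (x, s)
      rw [Set.Icc.coe_one, clip_of_one_le (a := 3 * (1 : ℝ) - 1) (by norm_num),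
        min_eq_right (by norm_num), mul_one, sub_self, mul_zero, clip_of_nonpos (a := (0 : ℝ)) le_rfl,
        Fw, Set.Icc.coe_one, mul_one]
      have e : (clip (1 - (s : ℝ) + s * ((1 + 1) / 3)) : ℝ) = 1 - s / 3 := by
        rw [coe_clip_of_mem (by linarith) (by linarith)]
        ring
      rw [w_ge _ _ (by rw [e]; linarith), e, clip_eq_coe (t := s) (by ring)]

/-! ### Attaching cones -/

/-- The inclusion of the base of the cone. -/
def coneIncl (X : PTop.{u}) : X ⟶ cone X :=
  ofMap (Y := cone X) ((mkMap X X.coneSet).comp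
    ((ContinuousMap.id _).prodMk (ContinuousMap.const _ 1))) (cone_mk_pt X 1)

lemma homotopic_const_iff {X Y : PTop.{u}} {f : X ⟶ Y} :
    Homotopic f (const X Y) ↔ ∃ g : cone X ⟶ Y, coneIncl X ≫ g = f := by
  constructor
  · intro h
    obtain ⟨F, h₁, h₂, h₃⟩ := h.symm.exists_homotopy
    refine ⟨desc (coneSet_mem X) F ?_, hom_ext h₃⟩
    rintro ⟨x, s⟩ (h | h)
    · change s = 0 at h
      rw [h, h₂]
      rfl
    · change x = X.pt at h
      rw [h, h₁]
  · rintro ⟨g, rfl⟩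
    refine Homotopic.symm (homotopic_of ((toMap g).comp (mkMap X X.coneSet)) (fun t => ?_)
      (fun x => ?_) fun _ => rfl)
    · exact (congrArg (toMap g) (cone_mk_pt X t)).trans (toMap_pt g)
    · exact (congrArg (toMap g) (cone_mk_zero x)).trans (toMap_pt g)

/-- Injectivity extends `f` to some `g` on the cone. The cones `k` and `p ∘ g` agree on the base and
glue to `d` on the suspension; a lift of `d` up to homotopy corrects `g`, and relative lifting makes
the result strict. -/
lemma hasLiftingProperty_coneIncl {E B X : PTop.{u}} (p : E ⟶ B) (h : HLP p (cone X))
    (hinj : ∀ f : X ⟶ E, Homotopic (f ≫ p) (const X B) → Homotopic f (const X E))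
    (hsurj : ∀ k : susp X ⟶ B, ∃ g : susp X ⟶ E, Homotopic (g ≫ p) k) :
    HasLiftingProperty (coneIncl X) p := by
  rw [hasLiftingProperty_iff]
  intro f k w
  obtain ⟨g, hg⟩ := homotopic_const_iff.1 (hinj f (homotopic_const_iff.2 ⟨k, w.symm⟩))
  let g' : C(X.right × I, E.right) := (toMap g).comp (mkMap X X.coneSet)
  let k' : C(X.right × I, B.right) := (toMap k).comp (mkMap X X.coneSet)
  have g₀ : ∀ x, g' (x, 0) = E.pt := fun x =>
    (congrArg (toMap g) (cone_mk_zero x)).trans (toMap_pt g)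
  have gpt : ∀ s, g' (X.pt, s) = E.pt := fun s =>
    (congrArg (toMap g) (cone_mk_pt X s)).trans (toMap_pt g)
  have g₁ : ∀ x, g' (x, 1) = toMap f x := fun x => congr_toMap hg x
  have k₀ : ∀ x, k' (x, 0) = B.pt := fun x =>
    (congrArg (toMap k) (cone_mk_zero x)).trans (toMap_pt k)
  have kpt : ∀ s, k' (X.pt, s) = B.pt := fun s =>
    (congrArg (toMap k) (cone_mk_pt X s)).trans (toMap_pt k)
  have k₁ : ∀ x, k' (x, 1) = toMap p (toMap f x) := fun x => (congr_toMap w x).symm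
  let r : C(X.right × I, B.right) := ⟨fun a => toMap p (g' (a.1, clip (1 - a.2))), by fun_prop⟩
  have r_apply : ∀ x s, r (x, s) = toMap p (g' (x, clip (1 - s))) := fun _ _ => rfl
  have hkr : ∀ x, k' (x, 1) = r (x, 0) := fun x => by
    rw [k₁, r_apply, clip_of_one_le (by simp), g₁]
  let d : C(X.right × I, B.right) := concat k' r hkr
  have hd : ∀ a ∈ X.suspSet, d a = B.pt := by
    rintro ⟨x, s⟩ (h | h | h)
    · change s = 0 at h
      rw [h, concat_zero, k₀]
    · change s = 1 at h
      rw [h, concat_one, r_apply, clip_of_nonpos (by simp), g₀, toMap_pt]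
    · change x = X.pt at h
      rw [h]
      exact concat_eq kpt fun s => by rw [r_apply, gpt, toMap_pt]
  obtain ⟨e, he⟩ := hsurj (desc (suspSet_mem X) d hd)
  obtain ⟨H, H₀, H₁, Hpt, He, Hd⟩ := homotopic_susp_iff.1 he
  replace Hd : ∀ x s, H (x, s, 1) = d (x, s) := Hd
  let e' : C(X.right × I, E.right) := (toMap e).comp (mkMap X X.suspSet)
  -- A homotopy from `p ∘ e'` to `k'`, the first half of `d`. On the side `s = 1` it rests until `t
  -- = 1/2` and then follows the second half of `d` backwards, which is `p ∘ g''`.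
  let K : C(X.right × I × I, B.right) :=
    ⟨fun a => H (a.1, clip (a.2.1 * min 1 (3 / 2 - (a.2.2 : ℝ))),
      clip ((1 - a.2.1) * a.2.2 + a.2.1 * min 1 (2 * (a.2.2 : ℝ)))), by fun_prop⟩
  have K_apply : ∀ x (s t : I), K (x, s, t) = H (x, clip (s * min 1 (3 / 2 - (t : ℝ))),
      clip ((1 - s) * t + s * min 1 (2 * (t : ℝ)))) := fun _ _ _ => rfl
  let g'' : C(X.right × I, E.right) := ⟨fun a => g' (a.1, clip (2 * a.2 - 1)), by fun_prop⟩
  have e_zero : ∀ x, e' (x, 0) = E.pt := by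
    exact fun x => (congrArg (toMap e) (susp_mk_zero x)).trans (toMap_pt e)
  have e_pt : ∀ s, e' (X.pt, s) = E.pt := by
    exact fun s => (congrArg (toMap e) (susp_mk_pt X s)).trans (toMap_pt e)
  have g_pt : ∀ t, g'' (X.pt, t) = E.pt := by
    exact fun t => gpt _
  have e_one : ∀ x, e' (x, 1) = g'' (x, 0) := by
    intro x
    change _ = g' (x, clip _)
    rw [clip_of_nonpos (by norm_num), g₀]
    exact (congrArg (toMap e) (susp_mk_one x)).trans (toMap_pt e)
  have K_zero : ∀ x t, K (x, 0, t) = B.pt := by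
    intro x t
    rw [K_apply, Set.Icc.coe_zero, zero_mul, clip_of_nonpos le_rfl, H₀]
  have K_pt : ∀ s t, K (X.pt, s, t) = B.pt := by
    exact fun s t => Hpt _ _
  have K_bottom : ∀ x s, K (x, s, 0) = toMap p (e' (x, s)) := by
    intro x s
    obtain ⟨hs, hs'⟩ := s.2
    rw [K_apply, Set.Icc.coe_zero, min_eq_left (by norm_num), mul_one, clip_coe,
      clip_of_nonpos (by rw [mul_zero, mul_zero, min_eq_right zero_le_one, mul_zero, add_zero]), He]
    rfl
  have K_side : ∀ x t, K (x, 1, t) = toMap p (g'' (x, t)) := by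
    intro x t
    obtain ⟨ht, ht'⟩ := t.2
    change _ = toMap p (g' (x, clip _))
    rw [K_apply, Set.Icc.coe_one, sub_self, zero_mul, zero_add, one_mul, one_mul]
    rcases le_total (t : ℝ) (1 / 2) with h | h
    · rw [min_eq_left (by linarith), clip_of_one_le le_rfl, H₁, clip_of_nonpos (by linarith), g₀,
        toMap_pt]
    · have e₁ : (clip (3 / 2 - (t : ℝ)) : ℝ) = 3 / 2 - t :=
        coe_clip_of_mem (by linarith) (by linarith)
      rw [min_eq_right (by linarith), min_eq_left (by linarith), clip_of_one_le le_rfl, Hd,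
        concat_of_ge (by rw [e₁]; linarith), e₁, r_apply,
        coe_clip_of_mem (by linarith) (by linarith)]
      congr 4
      ring
  obtain ⟨G, hG₀, hGpt, -, hG₁, hG⟩ := h.cone_rel e' g'' K e_zero e_pt g_pt e_one K_zero K_pt K_bottom K_side
  refine ⟨desc (coneSet_mem X) ⟨fun a => G (a.1, a.2, 1), by fun_prop⟩ ?_, hom_ext fun x => ?_,
    collapse_hom_ext fun x s => ?_⟩
  · rintro ⟨x, s⟩ (h | h)
    · change s = 0 at h
      exact h ▸ hG₀ x 1
    · change x = X.pt at h
      exact h ▸ hGpt s 1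
  · refine (hG₁ x 1).trans ?_
    change g' (x, clip _) = _
    rw [clip_of_one_le (by norm_num), g₁]
  · obtain ⟨hs, hs'⟩ := s.2
    refine (hG x s 1).trans ?_
    rw [K_apply]
    have e₁ : (1 - (s : ℝ)) * ((1 : I) : ℝ) + s * min 1 (2 * ((1 : I) : ℝ)) = 1 := by
      rw [Set.Icc.coe_one, min_eq_left (by norm_num)]
      ring
    have e₂ : (s : ℝ) * min 1 (3 / 2 - ((1 : I) : ℝ)) = s / 2 := by
      rw [Set.Icc.coe_one, min_eq_right (by norm_num)]
      ring
    have e₃ : (clip ((s : ℝ) / 2) : ℝ) = s / 2 := coe_clip_of_mem (by linarith) (by linarith)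
    rw [e₁, e₂, clip_of_one_le le_rfl, Hd, concat_of_le (by rw [e₃]; linarith), e₃,
      clip_eq_coe (t := s) (by ring)]
    rfl

lemma exists_lift_susp {E B X : PTop.{u}} (p : E ⟶ B) [HasLiftingProperty (coneIncl X) p]
    (k : susp X ⟶ B) : ∃ g : susp X ⟶ E, g ≫ p = k := by
  have := (hasLiftingProperty_iff (coneIncl X) p).1 inferInstance (const X E)
    (desc (coneSet_mem X) ((toMap k).comp (mkMap X X.suspSet)) ?_) ?_
  · obtain ⟨l, h₁, h₂⟩ := this
    refine ⟨desc (suspSet_mem X) ((toMap l).comp (mkMap X X.coneSet)) ?_,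
      collapse_hom_ext fun x s => congr_toMap h₂ (mkMap X X.coneSet (x, s))⟩
    rintro ⟨x, s⟩ (h | h | h)
    · change s = 0 at h
      exact h ▸ (congrArg (toMap l) (cone_mk_zero x)).trans (toMap_pt l)
    · change s = 1 at h
      exact h ▸ congr_toMap h₁ x
    · change x = X.pt at h
      exact h ▸ (congrArg (toMap l) (cone_mk_pt X s)).trans (toMap_pt l)
  · rintro ⟨x, s⟩ (h | h)
    · change s = 0 at h
      exact h ▸ (congrArg (toMap k) (susp_mk_zero x)).trans (toMap_pt k)
    · change x = X.pt at h
      exact h ▸ (congrArg (toMap k) (susp_mk_pt X s)).trans (toMap_pt k)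
  · rw [const_comp]
    exact hom_ext fun x => ((congrArg (toMap k) (susp_mk_one x)).trans (toMap_pt k)).symm

/-! ### Generating cofibrations -/

lemma isSmall_sup (M N : MorphismProperty PTop.{u}) [MorphismProperty.IsSmall.{u} M]
    [MorphismProperty.IsSmall.{u} N] : MorphismProperty.IsSmall.{u} (M ⊔ N) := by
  rw [sup_eq_iSup]
  have : ∀ b : Bool, MorphismProperty.IsSmall.{u} (cond b M N) := by
    rintro (_ | _) <;> assumption
  infer_instance

/-- The inclusions of the bottoms of cylinders that define the `A`-fibrations. -/
def generatingTrivialCofibrations (A : PTop.{u}) : MorphismProperty PTop.{u} :=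
  .ofHoms (fun n : ℕ => i₀ (cone (suspIter n A))) ⊔ .ofHoms (fun n : ℕ => i₀ (cylIter n A))

/-- The inclusions along which `A`-cells are attached. -/
def attachingInclusions (A : PTop.{u}) : MorphismProperty PTop.{u} :=
  .ofHoms (fun n : ℕ => coneIncl (suspIter n A)) ⊔
    .ofHoms (fun _ : Unit => const (of PUnit.{u + 1} ⟨⟩) A)

/-- A set of maps that detects the `A`-fibrations that are `A`-weak equivalences. -/
def generatingCofibrations (A : PTop.{u}) : MorphismProperty PTop.{u} :=
  generatingTrivialCofibrations A ⊔ attachingInclusions A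

instance (A : PTop.{u}) : MorphismProperty.IsSmall.{u} (generatingCofibrations A) := by
  have h₁ : MorphismProperty.IsSmall.{u} (generatingTrivialCofibrations A) :=
    have := MorphismProperty.isSmall_ofHoms.{u} (fun n : ℕ => i₀ (cone (suspIter n A)))
    have := MorphismProperty.isSmall_ofHoms.{u} (fun n : ℕ => i₀ (cylIter n A))
    isSmall_sup _ _
  have h₂ : MorphismProperty.IsSmall.{u} (attachingInclusions A) :=
    have := MorphismProperty.isSmall_ofHoms.{u} (fun n : ℕ => coneIncl (suspIter n A))
    have := MorphismProperty.isSmall_ofHoms.{u} (fun _ : Unit => const (of PUnit.{u + 1} ⟨⟩) A)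
    isSmall_sup _ _
  exact isSmall_sup _ _

lemma rlp_generatingTrivialCofibrations (A : PTop.{u}) :
    (generatingTrivialCofibrations A).rlp = fib A := by
  ext E B p
  constructor
  · intro h
    exact ⟨fun n => h _ (Or.inl ⟨n⟩), fun n => h _ (Or.inr ⟨n⟩)⟩
  · rintro ⟨h₁, h₂⟩ X Y i (h | h)
    · obtain ⟨n⟩ := h
      exact h₁ n
    · obtain ⟨n⟩ := h
      exact h₂ n

lemma rlp_generatingCofibrations_iff (A : PTop.{u}) {E B : PTop.{u}} (p : E ⟶ B) :
    (generatingCofibrations A).rlp p ↔ fib A p ∧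
      (∀ n, HasLiftingProperty (coneIncl (suspIter n A)) p) ∧
      ∀ k : A ⟶ B, ∃ g : A ⟶ E, g ≫ p = k := by
  rw [← rlp_generatingTrivialCofibrations]
  have base : HasLiftingProperty (const (of PUnit.{u + 1} ⟨⟩) A) p ↔
      ∀ k : A ⟶ B, ∃ g : A ⟶ E, g ≫ p = k := by
    rw [hasLiftingProperty_iff]
    constructor
    · intro h k
      obtain ⟨g, -, hg⟩ := h (const _ E) k (by rw [const_comp, const_comp])
      exact ⟨g, hg⟩
    · intro h f k _
      obtain ⟨g, hg⟩ := h k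
      refine ⟨g, ?_, hg⟩
      rw [const_comp]
      exact hom_ext fun x => (toMap_pt f).symm
  rw [← base]
  constructor
  · intro h
    exact ⟨fun _ _ _ hi => h _ (Or.inl hi), fun n => h _ (Or.inr (Or.inl ⟨n⟩)),
      h _ (Or.inr (Or.inr ⟨()⟩))⟩
  · rintro ⟨h₁, h₂, h₃⟩ X Y i (hi | hi | hi)
    · exact h₁ _ hi
    · obtain ⟨n⟩ := hi
      exact h₂ n
    · obtain ⟨⟩ := hi
      exact h₃

lemma embeddings_of_retraction {X Y : PTop.{u}} (i : X ⟶ Y) (r : Y ⟶ X) (h : i ≫ r = 𝟙 X) :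
    embeddings i :=
  .of_leftInverse (fun x => congr_toMap h x) (toMap r).continuous (toMap i).continuous

lemma embeddings_i₀ (X : PTop.{u}) : embeddings (i₀ X) :=
  embeddings_of_retraction _
    (toCyl (curry ⟨fun a : X.right × I => a.1, continuous_fst⟩ fun _ => rfl)) rfl

/-- An open `U` is the trace of a saturated open subset of `X × I`: `U × I ∪ X × [0, 1)` if `U`
contains the base point, and `U × (0, 1]` otherwise. -/
lemma embeddings_coneIncl (X : PTop.{u}) : embeddings (coneIncl X) := by
  have inj : Function.Injective (toMap (coneIncl X)) := by
    intro x y hxy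
    rcases Quotient.exact hxy with h | ⟨h | h, h' | h'⟩
    · exact congrArg Prod.fst h
    · exact (zero_ne_one h.symm).elim
    · exact (zero_ne_one h.symm).elim
    · exact (zero_ne_one h'.symm).elim
    · exact Eq.trans h (Eq.symm h')
  refine ⟨⟨le_antisymm (toMap (coneIncl X)).continuous.le_induced ?_⟩, inj⟩
  intro U hU
  suffices h : ∃ V : Set (X.right × I), IsOpen V ∧ (∀ a ∈ X.coneSet, a ∈ V ↔ (X.pt, 0) ∈ V) ∧
      ∀ x, (x, 1) ∈ V ↔ x ∈ U by
    obtain ⟨V, hV, hs, h₁⟩ := h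
    let F : cone X ⟶ of (ULift.{u} Prop) ⟨(X.pt, 0) ∈ V⟩ :=
      desc (Y := of (ULift.{u} Prop) ⟨(X.pt, 0) ∈ V⟩) (coneSet_mem X)
        ⟨fun a => ULift.up.{u} (a ∈ V), continuous_uliftUp.comp (continuous_Prop.2 hV)⟩
        fun a ha => ULift.ext _ _ (propext (hs a ha))
    refine ⟨{y | ULift.down.{u} (toMap F y)},
      continuous_Prop.1 (continuous_uliftDown.comp (toMap F).continuous), ?_⟩
    ext x
    exact h₁ x
  by_cases hpt : X.pt ∈ U
  · refine ⟨{a | a.1 ∈ U} ∪ {a | (a.2 : ℝ) < 1}, (hU.preimage continuous_fst).union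
      (isOpen_lt (by fun_prop) continuous_const), ?_, fun x => ?_⟩
    · have : (X.pt, (0 : I)) ∈ {a : X.right × I | a.1 ∈ U} ∪ {a | (a.2 : ℝ) < 1} := Or.inl hpt
      rintro ⟨x, s⟩ (h | h)
      · change s = 0 at h
        subst h
        exact iff_of_true (Or.inr (by simp)) this
      · change x = X.pt at h
        subst h
        exact iff_of_true (Or.inl hpt) this
    · simp
  · refine ⟨{a | a.1 ∈ U} ∩ {a | 0 < (a.2 : ℝ)}, (hU.preimage continuous_fst).inter
      (isOpen_lt continuous_const (by fun_prop)), ?_, fun x => ?_⟩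
    · have : (X.pt, (0 : I)) ∉ {a : X.right × I | a.1 ∈ U} ∩ {a | 0 < (a.2 : ℝ)} :=
        fun h => hpt h.1
      rintro ⟨x, s⟩ (h | h)
      · change s = 0 at h
        subst h
        exact iff_of_false (fun h => by simpa using h.2) this
      · change x = X.pt at h
        subst h
        exact iff_of_false (fun h => hpt h.1) this
    · simp

lemma generatingCofibrations_le_embeddings (A : PTop.{u}) :
    generatingCofibrations A ≤ embeddings := by
  rintro X Y i ((hi | hi) | hi | hi) <;> obtain ⟨⟩ := hi
  · exact embeddings_i₀ _
  · exact embeddings_i₀ _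
  · exact embeddings_coneIncl _
  · exact embeddings_of_retraction _ (const A _) (hom_ext fun _ => rfl)

instance (A : PTop.{u}) :
    MorphismProperty.HasSmallObjectArgument.{u} (generatingCofibrations A) :=
  hasSmallObjectArgument _ (generatingCofibrations_le_embeddings A)

/-! ### Weak equivalences -/

/-- The functor `[X, -]`. -/
def homotopyFunctor (X : PTop.{u}) : PTop.{u} ⥤ Type u where
  obj Y := HomotopyClasses X Y
  map f := TypeCat.ofHom (HomotopyClasses.map X f)
  map_id Y := by
    ext a
    obtain ⟨a, rfl⟩ := Quotient.exists_rep a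
    rfl
  map_comp f g := by
    ext a
    obtain ⟨a, rfl⟩ := Quotient.exists_rep a
    rfl

/-- As inverse images of isomorphisms, weak equivalences inherit two-out-of-three and closure under
retracts. -/
lemma weakEquiv_eq (A : PTop.{u}) : weakEquiv A = fun _ _ f => ∀ n : ℕ,
    (MorphismProperty.isomorphisms (Type u)).inverseImage (homotopyFunctor (suspIter n A)) f := by
  ext X Y f
  exact forall_congr' fun n =>
    (isIso_iff_bijective ((homotopyFunctor (suspIter n A)).map f)).symm

instance (A : PTop.{u}) : (weakEquiv A).HasTwoOutOfThreeProperty where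
  comp_mem f g hf hg n := by
    rw [weakEquiv_eq] at hf hg
    have := MorphismProperty.comp_mem _ _ _ (hf n) (hg n)
    exact (isIso_iff_bijective _).1 this
  of_postcomp f g hg hfg n := by
    rw [weakEquiv_eq] at hg hfg
    have := MorphismProperty.of_postcomp _ _ _ (hg n) (hfg n)
    exact (isIso_iff_bijective _).1 this
  of_precomp f g hf hfg n := by
    rw [weakEquiv_eq] at hf hfg
    have := MorphismProperty.of_precomp _ _ _ (hf n) (hfg n)
    exact (isIso_iff_bijective _).1 this

instance (A : PTop.{u}) : (weakEquiv A).IsStableUnderRetracts where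
  of_retract {X Y Z W f g} h hg n := by
    rw [weakEquiv_eq] at hg
    have : MorphismProperty.isomorphisms (Type u) ((homotopyFunctor (suspIter n A)).map f) :=
      MorphismProperty.of_retract (h.map (homotopyFunctor (suspIter n A))) (hg n)
    exact (isIso_iff_bijective _).1 this

lemma injective_map_iff {X Y Z : PTop.{u}} (f : Y ⟶ Z) :
    Function.Injective (HomotopyClasses.map X f) ↔
      ∀ g h : X ⟶ Y, Homotopic (g ≫ f) (h ≫ f) → Homotopic g h := by
  constructor
  · intro H g h w
    exact Quotient.exact (H (a₁ := Quotient.mk (homotopySetoid X Y) g)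
      (a₂ := Quotient.mk (homotopySetoid X Y) h) (Quotient.sound w))
  · rintro H ⟨g⟩ ⟨h⟩ w
    exact Quotient.sound (H g h (Quotient.exact w))

lemma surjective_map_iff {X Y Z : PTop.{u}} (f : Y ⟶ Z) :
    Function.Surjective (HomotopyClasses.map X f) ↔
      ∀ k : X ⟶ Z, ∃ g : X ⟶ Y, Homotopic (g ≫ f) k := by
  constructor
  · intro H k
    obtain ⟨⟨g⟩, hg⟩ := H (Quotient.mk (homotopySetoid X Z) k)
    exact ⟨g, Quotient.exact hg⟩
  · rintro H ⟨k⟩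
    obtain ⟨g, hg⟩ := H k
    exact ⟨Quotient.mk (homotopySetoid X Y) g, Quotient.sound hg⟩

lemma weakEquiv_of_homotopyEquiv (A : PTop.{u}) {X Y : PTop.{u}} (f : X ⟶ Y) (g : Y ⟶ X)
    (h₁ : Homotopic (f ≫ g) (𝟙 X)) (h₂ : Homotopic (g ≫ f) (𝟙 Y)) : weakEquiv A f := by
  intro n
  refine ⟨(injective_map_iff f).2 fun a b h => ?_, (surjective_map_iff f).2 fun k => ⟨k ≫ g, ?_⟩⟩
  · have ha := h₁.comp_left a
    have hb := h₁.comp_left b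
    rw [Category.comp_id] at ha hb
    have := h.comp_right g
    rw [Category.assoc, Category.assoc] at this
    exact ha.symm.trans (this.trans hb)
  · have := h₂.comp_left k
    rwa [Category.comp_id, ← Category.assoc] at this

lemma suspIter_succ (n : ℕ) (A : PTop.{u}) : suspIter (n + 1) A = susp (suspIter n A) :=
  Function.iterate_succ_apply' _ _ _

lemma HasDifferences.suspIter {A : PTop.{u}} (hA : HasDifferences A) (n : ℕ) :
    HasDifferences (suspIter n A) := by
  cases n with
  | zero => exact hA
  | succ n =>
    rw [suspIter_succ]
    exact hasDifferences_susp _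

/-- The trivial fibrations are detected by the generating cofibrations. -/
lemma rlp_generatingCofibrations {A : PTop.{u}} (hA : HasDifferences A) :
    (generatingCofibrations A).rlp = fib A ⊓ weakEquiv A := by
  ext E B p
  rw [rlp_generatingCofibrations_iff]
  constructor
  · rintro ⟨hp, h, h₀⟩
    refine ⟨hp, fun n => ⟨(injective_map_iff p).2 fun f g w => ?_,
      (surjective_map_iff p).2 fun k => ?_⟩⟩
    · obtain ⟨d, hd, hd'⟩ := hA.suspIter n f g
      obtain ⟨k, hk⟩ := homotopic_const_iff.1 (hd p w)
      obtain ⟨l, hl, -⟩ := (hasLiftingProperty_iff _ _).1 (h n) d k hk.symm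
      exact hd' (homotopic_const_iff.2 ⟨l, hl⟩)
    · have : ∃ g, g ≫ p = k := by
        cases n with
        | zero => exact h₀ k
        | succ n =>
          revert k
          rw [suspIter_succ]
          intro k
          have := h n
          exact exists_lift_susp p k
      obtain ⟨g, rfl⟩ := this
      exact ⟨g, Homotopic.refl _⟩
  · rintro ⟨hp, hw⟩
    refine ⟨hp, fun n => hasLiftingProperty_coneIncl p (hp.1 n) (fun f hf => ?_) ?_, fun k => ?_⟩
    · refine (injective_map_iff p).1 (hw n).1 f (const _ _) ?_
      rwa [const_comp]
    · rw [← suspIter_succ]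
      exact (surjective_map_iff p).1 (hw (n + 1)).2
    · have hs : ∀ k : A ⟶ B, ∃ g : A ⟶ E, Homotopic (g ≫ p) k :=
        (surjective_map_iff p).1 (hw 0).2
      obtain ⟨g, hg⟩ := hs k
      obtain ⟨H, h₁, h₂⟩ := homotopic_iff.1 hg
      obtain ⟨G, -, h₄⟩ := (HLP_iff p A).1 (hp.2 0) g H h₁
      exact ⟨G ≫ evalAt E 1, by rw [Category.assoc, ← pathMap_evalAt, ← Category.assoc, h₄, h₂]⟩

/-! ### The mapping path space -/

/-- Every map factors as a homotopy equivalence followed by a map with the homotopy lifting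
property with respect to all spaces. -/
lemma exists_mappingPath_factorization {X Y : PTop.{u}} (f : X ⟶ Y) :
    ∃ (N : PTop.{u}) (j : X ⟶ N) (q : N ⟶ Y), j ≫ q = f ∧ (∀ W, HLP q W) ∧
      ∀ A, weakEquiv A j := by
  let T := {a : X.right × C(I, Y.right) // a.2 0 = toMap f a.1}
  let N : PTop.{u} := of T ⟨(X.pt, ContinuousMap.const I Y.pt), (toMap_pt f).symm⟩
  let fst : C(T, X.right) := ⟨fun a => a.1.1, by fun_prop⟩
  let snd : C(T, C(I, Y.right)) := ⟨fun a => a.1.2, by fun_prop⟩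
  let r : N ⟶ X := ofMap (X := N) fst rfl
  let j : X ⟶ N := ofMap (Y := N)
    ⟨fun x => ⟨(x, ContinuousMap.const I (toMap f x)), rfl⟩, by
      refine Continuous.subtype_mk (continuous_id.prodMk ?_) _
      exact ContinuousMap.continuous_const'.comp (toMap f).continuous⟩
    (Subtype.ext (Prod.ext rfl (ContinuousMap.ext fun _ => toMap_pt f)))
  let q : N ⟶ Y := ofMap (X := N) ⟨fun a => snd a 1,
    (continuous_eval_const (F := C(I, Y.right)) 1).comp snd.continuous⟩ rfl
  refine ⟨N, j, q, rfl, fun W => ?_, fun A => weakEquiv_of_homotopyEquiv A j r ?_ ?_⟩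
  · refine (HLP_iff q W).2 fun g H w => ?_
    let gs : C(W.right × I, Y.right) := ContinuousMap.uncurry (snd.comp (toMap g))
    have gs_one : ∀ x, gs (x, 1) = uncurry H (x, 0) := fun x => (congr_toMap w x).symm
    -- At time `t` the given path is followed by `H` on `[0, t]`, at speed `1 + t`, so the path is
    -- unchanged at `t = 0`.
    let γ : C((W.right × I) × I, Y.right) :=
      { toFun := fun a => if (a.2 * (1 + a.1.2) : ℝ) ≤ 1 then gs (a.1.1, clip (a.2 * (1 + a.1.2)))
          else uncurry H (a.1.1, clip (a.2 * (1 + a.1.2) - 1))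
        continuous_toFun := by
          refine Continuous.if_le (by fun_prop) (by fun_prop) (by fun_prop) (by fun_prop) ?_
          intro a ha
          rw [ha, clip_of_one_le le_rfl, clip_of_nonpos (by norm_num), gs_one] }
    have gspt : ∀ t, gs (W.pt, t) = Y.pt := fun t =>
      congrArg (fun y : T => y.1.2 t) (toMap_pt g)
    let G : C(W.right × I, T) :=
      ⟨fun a => ⟨(fst (toMap g a.1), γ.curry a), by
        change γ (a, 0) = _
        refine (if_pos (by simp)).trans ?_
        rw [Set.Icc.coe_zero, zero_mul, clip_of_nonpos le_rfl]
        exact (toMap g a.1).2⟩, by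
        refine Continuous.subtype_mk (Continuous.prodMk ?_ γ.curry.continuous) _
        exact fst.continuous.comp ((toMap g).continuous.comp continuous_fst)⟩
    refine ⟨curry (Y := N) G fun t => Subtype.ext (Prod.ext ?_ (ContinuousMap.ext fun s => ?_)),
      hom_ext fun x => Subtype.ext (Prod.ext rfl (ContinuousMap.ext fun s => ?_)),
      hom_ext fun x => path_ext fun t => ?_⟩
    · exact congrArg fst (toMap_pt g)
    · change (if _ then gs (W.pt, _) else uncurry H (W.pt, _)) = Y.pt
      rw [gspt, uncurry_pt, ite_self]
    · refine (if_pos ?_).trans ?_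
      · simpa using s.2.2
      · rw [Set.Icc.coe_zero, add_zero, mul_one, clip_coe]
        rfl
    · change (if _ then gs (x, _) else uncurry H (x, _)) = uncurry H (x, t)
      obtain ⟨ht, ht'⟩ := t.2
      rw [Set.Icc.coe_one, one_mul]
      split_ifs with h
      · change 1 + (t : ℝ) ≤ 1 at h
        have : t = 0 := Subtype.ext (le_antisymm (show (t : ℝ) ≤ 0 by linarith) ht)
        rw [this, Set.Icc.coe_zero, add_zero, clip_of_one_le le_rfl, gs_one]
      · rw [clip_eq_coe (t := t) (by ring)]
  · exact Homotopic.refl _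
  -- Paths are shrunk to their starting points.
  · let γ : C((T × I) × I, Y.right) :=
      ⟨fun a => ContinuousMap.uncurry snd (a.1.1, clip (a.2 * a.1.2)), by fun_prop⟩
    refine homotopic_of (X := N) (Y := N) ⟨fun a => ⟨(fst a.1, γ.curry a), ?_⟩, ?_⟩
      (fun t => rfl) (fun a => ?_) fun a => ?_
    · change a.1.1.2 (clip (((0 : I) : ℝ) * _)) = _
      rw [Set.Icc.coe_zero, zero_mul, clip_of_nonpos le_rfl]
      exact a.1.2
    · refine Continuous.subtype_mk (Continuous.prodMk ?_ γ.curry.continuous) _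
      exact fst.continuous.comp continuous_fst
    · refine Subtype.ext (Prod.ext rfl (ContinuousMap.ext fun s => ?_))
      change a.1.2 (clip (_ * ((0 : I) : ℝ))) = _
      rw [Set.Icc.coe_zero, mul_zero, clip_of_nonpos le_rfl]
      exact a.2
    · refine Subtype.ext (Prod.ext rfl (ContinuousMap.ext fun s => ?_))
      change a.1.2 (clip (_ * ((1 : I) : ℝ))) = _
      rw [Set.Icc.coe_one, mul_one, clip_coe]
      rfl

/-! ### The weak factorization systems -/

instance (A : PTop.{u}) : (fib A).IsStableUnderRetracts := by
  rw [← rlp_generatingTrivialCofibrations]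
  infer_instance

instance (A : PTop.{u}) : (fib A).IsStableUnderBaseChange := by
  rw [← rlp_generatingTrivialCofibrations]
  infer_instance

instance (A : PTop.{u}) : (fib A).IsStableUnderComposition := by
  rw [← rlp_generatingTrivialCofibrations]
  infer_instance

instance (A : PTop.{u}) : (cof A).IsStableUnderRetracts :=
  inferInstanceAs (MorphismProperty.llp _).IsStableUnderRetracts

lemma isWeakFactorizationSystem_cof {A : PTop.{u}} (hA : HasDifferences A) :
    MorphismProperty.IsWeakFactorizationSystem (cof A) (fib A ⊓ weakEquiv A) := by
  rw [cof, ← rlp_generatingCofibrations hA]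
  exact ⟨MorphismProperty.rlp_llp_rlp _, rfl, inferInstance⟩

/-- Trivial cofibrations lift against fibrations. -/
lemma hasLiftingProperty_of_trivialCofibration {A X Y E B : PTop.{u}} {i : X ⟶ Y} {p : E ⟶ B}
    (hi : cof A i) (hw : weakEquiv A i) (hp : fib A p) : HasLiftingProperty i p := by
  rw [hasLiftingProperty_iff]
  intro f g w
  -- The composite `N → Y` is a fibration, and by two-out-of-three a weak equivalence. Lifting `i`
  -- against it gives a section extending `j`, and projecting to `E` gives the required lift.
  obtain ⟨N, j, q, hjq, hq, hj⟩ := exists_mappingPath_factorization (pullback.lift i f w.symm)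
  have e : j ≫ q ≫ pullback.fst g p = i := by
    rw [← Category.assoc, hjq, pullback.lift_fst]
  have hfib : fib A (q ≫ pullback.fst g p) :=
    MorphismProperty.comp_mem _ _ _ ⟨fun _ => hq _, fun _ => hq _⟩
      (MorphismProperty.pullback_fst _ _ hp)
  have hwe : weakEquiv A (q ≫ pullback.fst g p) :=
    MorphismProperty.of_precomp _ j _ (hj A) (by rwa [e])
  obtain ⟨l, hl, hl'⟩ := (hasLiftingProperty_iff _ _).1 (hi _ ⟨hfib, hwe⟩) j (𝟙 Y)
    (by rw [e, Category.comp_id])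
  refine ⟨l ≫ q ≫ pullback.snd g p, ?_, ?_⟩
  · rw [← Category.assoc, hl, ← Category.assoc, hjq, pullback.lift_snd]
  · rw [Category.assoc, Category.assoc, ← pullback.condition, ← Category.assoc q,
      ← Category.assoc l, hl', Category.id_comp]

/-- Factor through the mapping path space, then factor `j` into a cofibration and a trivial
fibration; the cofibration is a weak equivalence by two-out-of-three. -/
lemma isWeakFactorizationSystem_fib {A : PTop.{u}} (hA : HasDifferences A) :
    MorphismProperty.IsWeakFactorizationSystem (cof A ⊓ weakEquiv A) (fib A) := by
  have := isWeakFactorizationSystem_cof hA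
  have : MorphismProperty.HasFactorization (cof A ⊓ weakEquiv A) (fib A) := by
    refine ⟨fun {X Y} f => ?_⟩
    obtain ⟨N, j, q, rfl, hq, hj⟩ := exists_mappingPath_factorization f
    let h := MorphismProperty.factorizationData (cof A) (fib A ⊓ weakEquiv A) j
    refine ⟨{ Z := h.Z, i := h.i, p := h.p ≫ q, fac := by rw [← Category.assoc, h.fac],
              hi := ⟨h.hi, ?_⟩, hp := ?_ }⟩
    · exact MorphismProperty.of_postcomp _ _ h.p h.hp.2 (by rw [h.fac]; exact hj A)
    · exact MorphismProperty.comp_mem _ _ _ h.hp.1 ⟨fun _ => hq _, fun _ => hq _⟩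
  exact .mk' _ _ fun i p hi hp => hasLiftingProperty_of_trivialCofibration hi.1 hi.2 hp

lemma isModelStructure {A : PTop.{u}} (hA : HasDifferences A) :
    IsModelStructure (TopBased A) := by
  have : HasFiniteLimits (TopBased A) := inferInstanceAs (HasFiniteLimits PTop.{u})
  have : HasFiniteColimits (TopBased A) := inferInstanceAs (HasFiniteColimits PTop.{u})
  have : (weakEquivalences (TopBased A)).HasTwoOutOfThreeProperty :=
    inferInstanceAs (weakEquiv A).HasTwoOutOfThreeProperty
  have : MorphismProperty.IsWeakFactorizationSystem (cofibrations (TopBased A))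
      (trivialFibrations (TopBased A)) := isWeakFactorizationSystem_cof hA
  have : MorphismProperty.IsWeakFactorizationSystem (trivialCofibrations (TopBased A))
      (fibrations (TopBased A)) := isWeakFactorizationSystem_fib hA
  exact ⟨ModelCategory.mk' _, rfl, rfl, rfl⟩

/-! ### Comparison of cores -/

lemma isQuillenAdjunction_of_le {A B : PTop.{u}} (hA : HasDifferences A) (hB : HasDifferences B)
    (hf : fib A ≤ fib B) (hw : weakEquiv A ≤ weakEquiv B) :
    IsQuillenAdjunction (TopBased.idAdjunction B A) where
  model_source := isModelStructure hB
  model_target := isModelStructure hA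
  map_cofibrations f := MorphismProperty.antitone_llp (inf_le_inf hf hw) f
  map_trivialCofibrations := by
    have h₁ := (isWeakFactorizationSystem_fib hA).llp
    have h₂ := (isWeakFactorizationSystem_fib hB).llp
    have : cof B ⊓ weakEquiv B ≤ cof A ⊓ weakEquiv A := by
      rw [← h₁, ← h₂]
      exact MorphismProperty.antitone_llp hf
    exact fun {_ _} f => this f
  map_fibrations f := hf f
  map_trivialFibrations f := inf_le_inf hf hw f

/-! ### Passing to a retract or a suspension of the core. -/

lemma HLP.of_retract {E B X Y : PTop.{u}} {p : E ⟶ B} (h : Retract X Y) (hp : HLP p Y) :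
    HLP p X := by
  rw [HLP_iff] at hp ⊢
  intro f H w
  obtain ⟨G, h₁, h₂⟩ := hp (h.r ≫ f) (h.r ≫ H) (by rw [Category.assoc, w, Category.assoc])
  exact ⟨h.i ≫ G, by rw [Category.assoc, h₁, h.retract_assoc],
    by rw [Category.assoc, h₂, h.retract_assoc]⟩

/-- The map of quotients of cylinders induced by a pointed map. -/
def collapseMap {X Y : PTop.{u}} (f : X ⟶ Y) {S : Set (X.right × I)} {T : Set (Y.right × I)}
    (hS : (X.pt, 0) ∈ S) (hT : (Y.pt, 0) ∈ T) (h : ∀ a ∈ S, (toMap f a.1, a.2) ∈ T) :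
    collapse X S ⟶ collapse Y T :=
  desc hS ⟨fun a => mkMap Y T (toMap f a.1, a.2), by fun_prop⟩ fun a ha => mkMap_eq_pt hT (h a ha)

/-- Quotients of cylinders preserve retracts. -/
def collapseRetract {X Y : PTop.{u}} (h : Retract X Y) {S : Set (X.right × I)}
    {T : Set (Y.right × I)} (hS : (X.pt, 0) ∈ S) (hT : (Y.pt, 0) ∈ T)
    (hST : ∀ a ∈ S, (toMap h.i a.1, a.2) ∈ T) (hTS : ∀ a ∈ T, (toMap h.r a.1, a.2) ∈ S) :
    Retract (collapse X S) (collapse Y T) where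
  i := collapseMap h.i hS hT hST
  r := collapseMap h.r hT hS hTS
  retract := collapse_hom_ext fun x s => by
    change mkMap X S (toMap h.r (toMap h.i x), s) = _
    rw [← toMap_comp, h.retract]
    rfl

lemma toMap_eq_pt {X Y : PTop.{u}} (f : X ⟶ Y) {x : X.right} (h : x = X.pt) :
    toMap f x = Y.pt := h ▸ toMap_pt f

/-- The reduced cylinder preserves retracts. -/
def cylRetract {X Y : PTop.{u}} (h : Retract X Y) : Retract (cyl X) (cyl Y) :=
  collapseRetract h (cylSet_mem X) (cylSet_mem Y) (fun _ => toMap_eq_pt h.i)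
    fun _ => toMap_eq_pt h.r

/-- The reduced cone preserves retracts. -/
def coneRetract {X Y : PTop.{u}} (h : Retract X Y) : Retract (cone X) (cone Y) :=
  collapseRetract h (coneSet_mem X) (coneSet_mem Y) (fun _ => Or.imp_right (toMap_eq_pt h.i))
    fun _ => Or.imp_right (toMap_eq_pt h.r)

/-- The reduced suspension preserves retracts. -/
def suspRetract {X Y : PTop.{u}} (h : Retract X Y) : Retract (susp X) (susp Y) :=
  collapseRetract h (suspSet_mem X) (suspSet_mem Y)
    (fun _ => Or.imp_right (Or.imp_right (toMap_eq_pt h.i)))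
    fun _ => Or.imp_right (Or.imp_right (toMap_eq_pt h.r))

/-- Iterated suspensions preserve retracts. -/
def suspIterRetract {X Y : PTop.{u}} (h : Retract X Y) :
    ∀ n : ℕ, Retract (suspIter n X) (suspIter n Y)
  | 0 => h
  | n + 1 => suspIterRetract (suspRetract h) n

/-- Iterated cylinders preserve retracts. -/
def cylIterRetract {X Y : PTop.{u}} (h : Retract X Y) :
    ∀ n : ℕ, Retract (cylIter n X) (cylIter n Y)
  | 0 => h
  | n + 1 => cylIterRetract (cylRetract h) n

lemma fib_le_of_retract {A B : PTop.{u}} (h : Retract B A) : fib A ≤ fib B :=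
  fun _ _ _ hp => ⟨fun n => (hp.1 n).of_retract (coneRetract (suspIterRetract h n)),
    fun n => (hp.2 n).of_retract (cylIterRetract h n)⟩

lemma bijective_map_of_retract {X Y E B : PTop.{u}} {f : E ⟶ B} (h : Retract X Y)
    (hf : Function.Bijective (HomotopyClasses.map Y f)) :
    Function.Bijective (HomotopyClasses.map X f) := by
  refine ⟨(injective_map_iff f).2 fun a b w => ?_, (surjective_map_iff f).2 fun k => ?_⟩
  · have := (injective_map_iff f).1 hf.1 (h.r ≫ a) (h.r ≫ b) (by simpa using w.comp_left h.r)
    simpa using this.comp_left h.i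
  · obtain ⟨g, hg⟩ := (surjective_map_iff f).1 hf.2 (h.r ≫ k)
    exact ⟨h.i ≫ g, by simpa using hg.comp_left h.i⟩

lemma weakEquiv_le_of_retract {A B : PTop.{u}} (h : Retract B A) : weakEquiv A ≤ weakEquiv B :=
  fun _ _ _ hf n => bijective_map_of_retract (suspIterRetract h n) (hf n)

/-- For cones the index shifts by one. For `𝕀ⁿ Σ A`, replacing `p` by its `n`-fold path space map
leaves the case of `Σ A`, which follows from that of `𝕀 A`. -/
lemma fib_le_fib_susp (A : PTop.{u}) : fib A ≤ fib (susp A) := by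
  refine fun E B p hp => ⟨fun n => hp.1 (n + 1), fun n => ?_⟩
  obtain ⟨E', B', q, hq⟩ := exists_HLP_cylIter_iff p n
  exact (hq _).2 (HLP.susp_of_cyl ((hq _).1 (hp.2 (n + 1))))

lemma weakEquiv_le_weakEquiv_susp (A : PTop.{u}) : weakEquiv A ≤ weakEquiv (susp A) :=
  fun _ _ _ hf n => hf (n + 1)

lemma fib_le_fib_suspIter (A : PTop.{u}) (n : ℕ) : fib A ≤ fib (suspIter n A) := by
  induction n generalizing A with
  | zero => exact le_rfl
  | succ n ih => exact (fib_le_fib_susp A).trans (ih (susp A))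

lemma weakEquiv_le_weakEquiv_suspIter (A : PTop.{u}) (n : ℕ) :
    weakEquiv A ≤ weakEquiv (suspIter n A) := by
  induction n generalizing A with
  | zero => exact le_rfl
  | succ n ih => exact (weakEquiv_le_weakEquiv_susp A).trans (ih (susp A))

end PTop

end

theorem mainTheorem8 :
    (∀ (A B : PTop.{u}) [CompactSpace A.right] [T1Space A.right]
      [CompactSpace B.right] [T1Space B.right],
      PTop.IsHCogroup A → PTop.IsHCogroup B → Nonempty (Retract B A) →
        IsQuillenAdjunction (TopBased.idAdjunction B A)) ∧
    (∀ (K : PTop.{u}) [CompactSpace K.right] [T2Space K.right] (n : ℕ), 1 ≤ n →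
      IsQuillenAdjunction
        (TopBased.idAdjunction (PTop.suspIter n (PTop.susp K)) (PTop.susp K))) := by
  refine ⟨fun A B _ _ _ _ hA hB ⟨h⟩ => ?_, fun K _ _ n _ => ?_⟩
  · exact PTop.isQuillenAdjunction_of_le hA.hasDifferences hB.hasDifferences
      (PTop.fib_le_of_retract h) (PTop.weakEquiv_le_of_retract h)
  · exact PTop.isQuillenAdjunction_of_le (PTop.hasDifferences_susp K)
      ((PTop.hasDifferences_susp K).suspIter n) (PTop.fib_le_fib_suspIter _ n)
      (PTop.weakEquiv_le_weakEquiv_suspIter _ n)
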